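/- Let $n,d\ge 0$ be integers, $V=\mathbb{Q}^n$, and let $S(n,d)=\operatorname{End}_{\Sigma_d}(V^{\otimes d})$ be the Schur algebra over $\mathbb{Q}$, that is, the algebra of all linear endomorphisms of $V^{\otimes d}$ commuting with the action of the symmetric group $\Sigma_d$ by permutation of the tensor places. Let $\Lambda(n,d)$ be the set of all $\lambda=(\lambda_1,\dots,\lambda_n)\in\mathbb{N}^n$ with $\lambda_1+\dots+\lambda_n=d$, let $\varepsilon_1,\dots,\varepsilon_n$ be the standard basis of $\mathbb{Z}^n$, and for $1\le i\le n-1$ write $\alpha_i=\varepsilon_i-\varepsilon_{i+1}$. Then $S(n,d)$ is isomorphic to the associative $\mathbb{Q}$-algebra with $1$ given by generators $1_\lambda$ ($\lambda\in\Lambda(n,d)$), $e_i$, $f_i$ ($1\le i\le n-1$) subject to the following relations, for all $\lambda,\mu\in\Lambda(n,d)$ and all $i,j\in\{1,\dots,n-1\}$: (S1) $1_\lambda 1_\mu=\delta_{\lambda,\mu}1_\lambda$ and $\sum_{\lambda\in\Lambda(n,d)}1_\lambda=1$; (S2) $e_i1_\lambda=1_{\lambda+\alpha_i}e_i$ if $\lambda+\alpha_i\in\Lambda(n,d)$,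 and $e_i1_\lambda=0$ otherwise; $f_i1_\lambda=1_{\lambda-\alpha_i}f_i$ if $\lambda-\alpha_i\in\Lambda(n,d)$, and $f_i1_\lambda=0$ otherwise; $1_\lambda e_i=e_i1_{\lambda-\alpha_i}$ if $\lambda-\alpha_i\in\Lambda(n,d)$, and $1_\lambda e_i=0$ otherwise; $1_\lambda f_i=f_i1_{\lambda+\alpha_i}$ if $\lambda+\alpha_i\in\Lambda(n,d)$, and $1_\lambda f_i=0$ otherwise; (S3) $e_if_j-f_je_i=\delta_{ij}\sum_{\lambda\in\Lambda(n,d)}(\lambda_j-\lambda_{j+1})1_\lambda$; (Serre relations) $e_i^2e_j-2e_ie_je_i+e_je_i^2=0$ and $f_i^2f_j-2f_if_jf_i+f_jf_i^2=0$ if $|i-j|=1$; $e_ie_j-e_je_i=0$ and $f_if_j-f_jf_i=0$ otherwise. More precisely, let a matrix $x\in\mathfrak{gl}_n(\mathbb{Q})$ act on $V^{\otimes d}$ as the sum over the $d$ tensor places of $1\otimes\cdots\otimes x\otimes\cdots\otimes 1$, and let $E_{ij}$ be the matrix units. There is an algebra isomorphism from the presented algebra onto $S(n,d)$ which sends $e_i$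 and $f_i$ to the actions of $E_{i,i+1}$ and $E_{i+1,i}$, and $1_\lambda$ to $\prod_{k=1}^n\binom{H_k}{\lambda_k}$, where $H_k$ is the action of $E_{kk}$ and $\binom{H}{b}=H(H-1)\cdots(H-b+1)/b!$. -/

import Mathlib

open scoped TensorProduct

noncomputable section

namespace SchurPresentation

/-- The natural module `V = ℚⁿ`. -/
abbrev V (n : ℕ) : Type := Fin n → ℚ

/-- The tensor power `V^{⊗ d}`. -/
abbrev TensorSpace (n d : ℕ) : Type := ⨂[ℚ] _ : Fin d, V n

/-- The action of a permutation on `V^{⊗ d}` by place permutation. -/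
def placePerm (n d : ℕ) (σ : Equiv.Perm (Fin d)) : Module.End ℚ (TensorSpace n d) :=
  (PiTensorProduct.reindex ℚ (fun _ : Fin d => V n) σ).toLinearMap

/-- The Schur algebra `S(n,d)` over `ℚ`: the algebra of all linear endomorphisms of `V^{⊗ d}`
commuting with the action of the symmetric group by place permutations. -/
def SchurAlgebra (n d : ℕ) : Subalgebra ℚ (Module.End ℚ (TensorSpace n d)) :=
  Subalgebra.centralizer ℚ (Set.range (placePerm n d))

/-- The action of a matrix `x ∈ 𝔤𝔩ₙ` on `V^{⊗ d}`, as a derivation: the sum over all places `k`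
of `1 ⊗ ⋯ ⊗ x ⊗ ⋯ ⊗ 1` with `x` at place `k`. -/
def glAction (n d : ℕ) (x : Matrix (Fin n) (Fin n) ℚ) : Module.End ℚ (TensorSpace n d) :=
  ∑ k : Fin d, PiTensorProduct.map
    (Function.update (fun _ : Fin d => (LinearMap.id : V n →ₗ[ℚ] V n)) k (Matrix.toLin' x))

/-- The index `i ∈ {1, …, n-1}`, as an element of `{1, …, n}`. -/
def idx {n : ℕ} (i : Fin (n - 1)) : Fin n := ⟨i.1, by omega⟩

/-- The index `i + 1` for `i ∈ {1, …, n-1}`, as an element of `{1, …, n}`. -/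
def idxSucc {n : ℕ} (i : Fin (n - 1)) : Fin n := ⟨i.1 + 1, by omega⟩

/-- `e_i`, the root vector `E_{i,i+1}`, acting on `V^{⊗ d}`. -/
def eOp (n d : ℕ) (i : Fin (n - 1)) : Module.End ℚ (TensorSpace n d) :=
  glAction n d (Matrix.single (idx i) (idxSucc i) 1)

/-- `f_i`, the root vector `E_{i+1,i}`, acting on `V^{⊗ d}`. -/
def fOp (n d : ℕ) (i : Fin (n - 1)) : Module.End ℚ (TensorSpace n d) :=
  glAction n d (Matrix.single (idxSucc i) (idx i) 1)

/-- `H_k`, the diagonal matrix unit `E_{k,k}`, acting on `V^{⊗ d}`. -/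
def hOp (n d : ℕ) (k : Fin n) : Module.End ℚ (TensorSpace n d) :=
  glAction n d (Matrix.single k k 1)

/-- The binomial coefficient `binom(a, b) = a (a - 1) ⋯ (a - b + 1) / b!` of an element `a` of a
`ℚ`-algebra. -/
def binom {A : Type*} [Ring A] [Algebra ℚ A] (a : A) (b : ℕ) : A :=
  (b.factorial : ℚ)⁻¹ • Polynomial.aeval a (descPochhammer ℚ b)

/-- `H_B = ∏_k binom(H_k, b_k)` on `V^{⊗ d}`, for `B ∈ ℕⁿ` (the factors commute with each other;
they are multiplied in the order `k = 1, …, n`). -/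
def HOp (n d : ℕ) (B : Fin n → ℕ) : Module.End ℚ (TensorSpace n d) :=
  (List.ofFn fun k : Fin n => binom (hOp n d k) (B k)).prod

/-- `Λ(n,d)`: the `n`-part compositions of `d`, i.e. the `l ∈ ℕⁿ` whose entries sum to `d`. -/
def Lam (n d : ℕ) : Type := {l : Fin n → ℕ // ∑ k, l k = d}

instance (n d : ℕ) : DecidableEq (Lam n d) :=
  inferInstanceAs (DecidableEq {l : Fin n → ℕ // ∑ k, l k = d})

instance (n d : ℕ) : Fintype (Lam n d) :=
  Fintype.subtype (Finset.piAntidiag Finset.univ d) (by simp)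

/-- An element of `Λ(n,d)` as a vector in `ℤⁿ`. -/
def Lam.toInt {n d : ℕ} (l : Lam n d) : Fin n → ℤ := fun k => (l.1 k : ℤ)

/-- The simple root `α_i = ε_i - ε_{i+1}` in `ℤⁿ`. -/
def simpleRoot {n : ℕ} (i : Fin (n - 1)) : Fin n → ℤ :=
  Pi.single (idx i) 1 - Pi.single (idxSucc i) 1

/-- The symbols `1_λ` (for `λ ∈ Λ(n,d)`), `e_i`, `f_i` (for `1 ≤ i ≤ n - 1`). -/
inductive Gen (n d : ℕ) : Type
  | one (l : Lam n d) : Gen n d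
  | e (i : Fin (n - 1)) : Gen n d
  | f (i : Fin (n - 1)) : Gen n d

/-- The free associative unital `ℚ`-algebra on the symbols. -/
abbrev Free (n d : ℕ) : Type := FreeAlgebra ℚ (Gen n d)

/-- The free generator `1_λ`. -/
def gOne {n d : ℕ} (l : Lam n d) : Free n d := FreeAlgebra.ι ℚ (Gen.one l)

/-- The free generator `e_i`. -/
def gE {n : ℕ} (d : ℕ) (i : Fin (n - 1)) : Free n d := FreeAlgebra.ι ℚ (Gen.e i)

/-- The free generator `f_i`. -/
def gF {n : ℕ} (d : ℕ) (i : Fin (n - 1)) : Free n d := FreeAlgebra.ι ℚ (Gen.f i)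

/-- The defining relations. -/
inductive Rel (n d : ℕ) : Free n d → Free n d → Prop
  /- orthogonal idempotents with sum 1 -/
  | one_mul_one (l m : Lam n d) :
      Rel n d (gOne l * gOne m) (if l = m then gOne l else 0)
  | sum_one : Rel n d (∑ l : Lam n d, gOne l) 1
  /- `e_i 1_λ` -/
  | e_one (i : Fin (n - 1)) (l m : Lam n d) (h : m.toInt = l.toInt + simpleRoot i) :
      Rel n d (gE d i * gOne l) (gOne m * gE d i)
  | e_one_zero (i : Fin (n - 1)) (l : Lam n d)
      (h : ∀ m : Lam n d, m.toInt ≠ l.toInt + simpleRoot i) :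
      Rel n d (gE d i * gOne l) 0
  /- `f_i 1_λ` -/
  | f_one (i : Fin (n - 1)) (l m : Lam n d) (h : m.toInt = l.toInt - simpleRoot i) :
      Rel n d (gF d i * gOne l) (gOne m * gF d i)
  | f_one_zero (i : Fin (n - 1)) (l : Lam n d)
      (h : ∀ m : Lam n d, m.toInt ≠ l.toInt - simpleRoot i) :
      Rel n d (gF d i * gOne l) 0
  /- `1_λ e_i` -/
  | one_e (i : Fin (n - 1)) (l m : Lam n d) (h : m.toInt = l.toInt - simpleRoot i) :
      Rel n d (gOne l * gE d i) (gE d i * gOne m)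
  | one_e_zero (i : Fin (n - 1)) (l : Lam n d)
      (h : ∀ m : Lam n d, m.toInt ≠ l.toInt - simpleRoot i) :
      Rel n d (gOne l * gE d i) 0
  /- `1_λ f_i` -/
  | one_f (i : Fin (n - 1)) (l m : Lam n d) (h : m.toInt = l.toInt + simpleRoot i) :
      Rel n d (gOne l * gF d i) (gF d i * gOne m)
  | one_f_zero (i : Fin (n - 1)) (l : Lam n d)
      (h : ∀ m : Lam n d, m.toInt ≠ l.toInt + simpleRoot i) :
      Rel n d (gOne l * gF d i) 0
  /- commutators of the `e_i` with the `f_j` -/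
  | e_f (i j : Fin (n - 1)) :
      Rel n d (gE d i * gF d j - gF d j * gE d i)
        (if i = j then
          ∑ l : Lam n d, ((l.1 (idx j) : ℚ) - (l.1 (idxSucc j) : ℚ)) • gOne l
        else 0)
  /- Serre relations -/
  | serre_e (i j : Fin (n - 1)) (h : |(i.1 : ℤ) - (j.1 : ℤ)| = 1) :
      Rel n d (gE d i ^ 2 * gE d j - 2 * gE d i * gE d j * gE d i + gE d j * gE d i ^ 2) 0
  | comm_e (i j : Fin (n - 1)) (h : |(i.1 : ℤ) - (j.1 : ℤ)| ≠ 1) :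
      Rel n d (gE d i * gE d j - gE d j * gE d i) 0
  | serre_f (i j : Fin (n - 1)) (h : |(i.1 : ℤ) - (j.1 : ℤ)| = 1) :
      Rel n d (gF d i ^ 2 * gF d j - 2 * gF d i * gF d j * gF d i + gF d j * gF d i ^ 2) 0
  | comm_f (i j : Fin (n - 1)) (h : |(i.1 : ℤ) - (j.1 : ℤ)| ≠ 1) :
      Rel n d (gF d i * gF d j - gF d j * gF d i) 0

/-- The associative unital `ℚ`-algebra presented by the generators and relations above. -/
abbrev Presented (n d : ℕ) : Type := RingQuot (Rel n d)

/-- The quotient map from the free algebra to the presented algebra. -/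
abbrev toPresented (n d : ℕ) : Free n d →ₐ[ℚ] Presented n d := RingQuot.mkAlgHom ℚ (Rel n d)

end SchurPresentation

end

open SchurPresentation

noncomputable section

/-! Sending the generators to `HOp`, `eOp`, `fOp` respects the relations, so it defines `tensorRep`
from the presented algebra P to End(V^{⊗d}). It remains to find its image and its kernel.

Injectivity uses a linear map going back. The Serre relations give a Lie homomorphism ρ from 𝔤𝔩ₙ to
P (`rho_bracket`). Normally ordered products are defined by N(X, v) = ρ(X) N(v) - Σ_t N(v with v_t
replaced by X v_t). On tensor space such a product would put its factors on distinct places, so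
length d + 1 should give zero. In P this is proved from the relations: for diagonal matrix units it
is a count over compositions of d (`normalProd_diag`), and commutators with ρ(E_ij) extend it to all
matrices (`normalProd_eq_zero`). Hence ρ(X) N(v₁, …, v_d) is just the sum of the N(…, X v_t, …), the
rule by which X multiplies v₁ ⊗ ⋯ ⊗ v_d. So the map `toPresEnd`, taking v₁ ⊗ ⋯ ⊗ v_d to N(v₁, …,
v_d), commutes with left multiplication by the ρ(X), and by the 1_λ, which are polynomials in the
H_k. Thus it is P-linear. It takes 1 to d!, so if x acts as zero then d! x = 0 and x = 0.

For the image, elements commuting with place permutations are averages of conjugates, hence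
combinations of symmetrized tensors. A symmetrized tensor is obtained from products of elements of
𝔤𝔩ₙ by induction on the number of its non-identity factors (`symTensor_mem_range`). -/

namespace SchurPresentation


/-! ### Derivations of multilinear maps -/

section Multilinear

variable {ι M N N' : Type*} [Fintype ι] [DecidableEq ι] [AddCommGroup M] [Module ℚ M]
  [AddCommGroup N] [Module ℚ N] [AddCommGroup N'] [Module ℚ N']

/-- An endomorphism `A` acts on multilinear maps `F` as a derivation: `A` is applied to one
argument at a time, and the results are added. -/
def der (A : Module.End ℚ M) (F : MultilinearMap ℚ (fun _ : ι => M) N) :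
    MultilinearMap ℚ (fun _ : ι => M) N :=
  ∑ t, F.compLinearMap (Function.update (fun _ => LinearMap.id) t A)

theorem der_apply (A : Module.End ℚ M) (F : MultilinearMap ℚ (fun _ : ι => M) N) (v : ι → M) :
    der A F v = ∑ t, F (Function.update v t (A (v t))) := by
  simp only [der, sum_apply, MultilinearMap.compLinearMap_apply]
  refine Finset.sum_congr rfl fun t _ => congrArg F ?_
  funext i
  by_cases h : i = t
  · subst h; simp
  · simp [h]

theorem der_add_left (A B : Module.End ℚ M) (F : MultilinearMap ℚ (fun _ : ι => M) N) :
    der (A + B) F = der A F + der B F := by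
  ext v
  simp [der_apply, Finset.sum_add_distrib]

theorem der_smul_left (c : ℚ) (A : Module.End ℚ M) (F : MultilinearMap ℚ (fun _ : ι => M) N) :
    der (c • A) F = c • der A F := by
  ext v
  simp [der_apply, Finset.smul_sum]

theorem der_neg_left (A : Module.End ℚ M) (F : MultilinearMap ℚ (fun _ : ι => M) N) :
    der (-A) F = -der A F := by
  rw [← neg_one_smul ℚ A, der_smul_left, neg_one_smul]

theorem der_sub_left (A B : Module.End ℚ M) (F : MultilinearMap ℚ (fun _ : ι => M) N) :
    der (A - B) F = der A F - der B F := by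
  rw [sub_eq_add_neg, der_add_left, der_neg_left, sub_eq_add_neg]

theorem der_sub_right (A : Module.End ℚ M) (F G : MultilinearMap ℚ (fun _ : ι => M) N) :
    der A (F - G) = der A F - der A G := by
  ext v
  simp [der_apply, Finset.sum_sub_distrib]

theorem der_compMultilinearMap (A : Module.End ℚ M) (g : N →ₗ[ℚ] N')
    (F : MultilinearMap ℚ (fun _ : ι => M) N) :
    der A (g.compMultilinearMap F) = g.compMultilinearMap (der A F) := by
  ext v
  simp [der_apply]

theorem der_one (F : MultilinearMap ℚ (fun _ : ι => M) N) :
    der (1 : Module.End ℚ M) F = (Fintype.card ι : ℚ) • F := by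
  ext v
  simp [der_apply, ← Nat.cast_smul_eq_nsmul ℚ]

theorem der_der_apply (A B : Module.End ℚ M) (F : MultilinearMap ℚ (fun _ : ι => M) N)
    (v : ι → M) :
    der A (der B F) v = der (B * A) F v + ∑ t, ∑ s, if s = t then 0 else
      F (Function.update (Function.update v t (A (v t))) s (B (v s))) := by
  simp only [der_apply]
  rw [← Finset.sum_add_distrib]
  refine Finset.sum_congr rfl fun t _ => ?_
  rw [← Finset.add_sum_erase _ _ (Finset.mem_univ t)]
  rw [← Finset.add_sum_erase (a := t) _ (fun s => if s = t then 0 else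
      F (Function.update (Function.update v t (A (v t))) s (B (v s)))) (Finset.mem_univ t)]
  simp only [Function.update_self, Function.update_idem, if_true, zero_add, Module.End.mul_apply]
  refine congrArg _ (Finset.sum_congr rfl fun s hs => ?_)
  have : s ≠ t := Finset.ne_of_mem_erase hs
  simp [this]

/-- Contributions at two different places are symmetric in the two operators and cancel; only those
at one place survive. The order is reversed because the operators act on the arguments: in `der A
(der B F)` the operator `A` is applied before `B`. -/
theorem der_der_sub (A B : Module.End ℚ M) (F : MultilinearMap ℚ (fun _ : ι => M) N) :
    der A (der B F) - der B (der A F) = der (B * A - A * B) F := by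
  ext v
  rw [sub_apply, der_der_apply, der_der_apply, der_sub_left,
    sub_apply]
  have : (∑ t, ∑ s, if s = t then 0 else
      F (Function.update (Function.update v t (A (v t))) s (B (v s)))) =
      ∑ t, ∑ s, if s = t then 0 else
      F (Function.update (Function.update v t (B (v t))) s (A (v s))) := by
    rw [Finset.sum_comm]
    refine Finset.sum_congr rfl fun t _ => Finset.sum_congr rfl fun s _ => ?_
    by_cases h : t = s
    · simp [h]
    · rw [if_neg h, if_neg (Ne.symm h), Function.update_comm h]
  rw [this]
  abel

theorem der_comp_perm {F : MultilinearMap ℚ (fun _ : ι => M) N}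
    (σ : Equiv.Perm ι) (hF : ∀ v : ι → M, F (v ∘ σ) = F v)
    (A : Module.End ℚ M) (v : ι → M) : der A F (v ∘ σ) = der A F v := by
  rw [der_apply, der_apply, ← Equiv.sum_comp σ fun t => F (Function.update v t (A (v t)))]
  refine Finset.sum_congr rfl fun t _ => ?_
  rw [← hF (Function.update v (σ t) (A (v (σ t)))), Function.update_comp_eq_of_injective _ σ.injective]
  rfl

theorem der_cons {r : ℕ} (A : Module.End ℚ M)
    (F : MultilinearMap ℚ (fun _ : Fin (r + 1) => M) N) (x : M) (v : Fin r → M) :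
    der A F (Fin.cons x v : Fin (r + 1) → M) =
      F (Fin.cons (A x) v : Fin (r + 1) → M) + der A (F.curryLeft x) v := by
  rw [der_apply, der_apply, Fin.sum_univ_succ]
  congr 1
  · simp
  · refine Finset.sum_congr rfl fun t _ => ?_
    simp [Fin.cons_update]

end Multilinear

/-! ### Normally ordered products -/

section NormalOrder

variable {M A : Type*} [Ring M] [Algebra ℚ M] [Ring A] [Algebra ℚ A]

/-- Left multiplication. -/
abbrev lm (a : A) : Module.End ℚ A := LinearMap.mulLeft ℚ a

/-- The normally ordered product of a sequence of elements of an associative algebra `M`, with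
respect to a linear map `ρ` from `M` to an algebra. -/
def normalProd (ρ : M →ₗ[ℚ] A) : (r : ℕ) → MultilinearMap ℚ (fun _ : Fin r => M) A
  | 0 => MultilinearMap.constOfIsEmpty ℚ _ 1
  | r + 1 => LinearMap.uncurryLeft
    -- The subtracted term removes the cases where `X` lands on a factor already present. For the
    -- action on tensor space this leaves the sum over all placements of the factors on distinct
    -- places.
    { toFun := fun X =>
        (lm (ρ X)).compMultilinearMap (normalProd ρ r) - der (lm X) (normalProd ρ r)
      map_add' := fun X Y => by
        ext v
        simp [der_apply, add_mul, Finset.sum_add_distrib]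
        abel
      map_smul' := fun c X => by
        ext v
        simp [der_apply, Finset.smul_sum, smul_sub] }

variable (ρ : M →ₗ[ℚ] A)

theorem normalProd_zero (v : Fin 0 → M) : normalProd ρ 0 v = 1 := rfl

theorem curryLeft_normalProd (r : ℕ) (X : M) :
    (normalProd ρ (r + 1)).curryLeft X =
      (lm (ρ X)).compMultilinearMap (normalProd ρ r) - der (lm X) (normalProd ρ r) := rfl

theorem normalProd_cons (r : ℕ) (X : M) (v : Fin r → M) :
    normalProd ρ (r + 1) (Fin.cons X v : Fin (r + 1) → M) =
      ρ X * normalProd ρ r v - der (lm X) (normalProd ρ r) v := rfl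

theorem map_mul_normalProd (r : ℕ) (X : M) (v : Fin r → M) :
    ρ X * normalProd ρ r v = normalProd ρ (r + 1) (Fin.cons X v : Fin (r + 1) → M) +
      der (lm X) (normalProd ρ r) v := by
  rw [normalProd_cons]; abel

variable {ρ}

/-- Exchanging `X` and `Y` changes the expansion by a bracket term from `ρ` and a commutator of two
derivations. Both express `[X, Y]`, with opposite signs. -/
theorem normalProd_cons_cons (hρ : ∀ X Y, ρ X * ρ Y - ρ Y * ρ X = ρ (X * Y - Y * X))
    (r : ℕ) (X Y : M) (v : Fin r → M) :
    normalProd ρ (r + 2) (Fin.cons X (Fin.cons Y v : Fin (r + 1) → M) : Fin (r + 2) → M) =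
      normalProd ρ (r + 2) (Fin.cons Y (Fin.cons X v : Fin (r + 1) → M) : Fin (r + 2) → M) := by
  have key := congrArg (fun F => F v) (der_der_sub (lm X) (lm Y) (normalProd ρ r))
  have h1 : lm Y * lm X - lm X * lm Y = lm (Y * X) - lm (X * Y) := by
    ext; simp
  rw [h1, der_sub_left] at key
  have h2 : ρ X * ρ Y * normalProd ρ r v - ρ Y * ρ X * normalProd ρ r v =
      ρ (X * Y) * normalProd ρ r v - ρ (Y * X) * normalProd ρ r v := by
    rw [← sub_mul, hρ, map_sub, sub_mul]
  simp only [sub_apply] at key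
  simp only [normalProd_cons, der_cons, curryLeft_normalProd, der_sub_right,
    der_compMultilinearMap, sub_apply, LinearMap.compMultilinearMap_apply,
    LinearMap.mulLeft_apply, mul_sub, ← mul_assoc]
  rw [← sub_eq_zero] at h2 key ⊢
  have h3 := congrArg₂ HAdd.hAdd h2 key
  rw [add_zero] at h3
  rw [← h3]
  abel

/-- Adjacent transpositions suffice. The first is `normalProd_cons_cons`; the others fix the leading
factor, so the recursion passes them to shorter products. -/
theorem normalProd_comp_perm (hρ : ∀ X Y, ρ X * ρ Y - ρ Y * ρ X = ρ (X * Y - Y * X))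
    (r : ℕ) (σ : Equiv.Perm (Fin r)) (v : Fin r → M) :
    normalProd ρ r (v ∘ σ) = normalProd ρ r v := by
  induction r with
  | zero => rw [Subsingleton.elim (v ∘ σ) v]
  | succ r ih =>
    cases r with
    | zero =>
      congr 1
      funext j
      exact congrArg v (Fin.ext (by omega))
    | succ r =>
    have hσ : σ ∈ Submonoid.closure (Set.range fun i : Fin (r + 1) =>
        Equiv.swap i.castSucc i.succ) := by
      rw [Equiv.Perm.mclosure_swap_castSucc_succ]; trivial
    induction hσ using Submonoid.closure_induction generalizing v with
    | one => rfl
    | mul σ τ _ _ h1 h2 =>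
      rw [Equiv.Perm.coe_mul, ← Function.comp_assoc, h2, h1]
    | mem σ h =>
      obtain ⟨i, rfl⟩ := h
      induction i using Fin.cases with
      | zero =>
        induction v using Fin.consCases with | _ X v =>
        induction v using Fin.consCases with | _ Y v =>
        rw [normalProd_cons_cons hρ]
        congr 1
        funext j
        refine Fin.cases ?_ (fun j => Fin.cases ?_ (fun j => ?_) j) j
        · simp
        · simp
        · simp only [Function.comp_apply]
          rw [Equiv.swap_apply_of_ne_of_ne] <;> simp [Fin.ext_iff]
      | succ i =>
        induction v using Fin.consCases with | _ X v =>
        have h : ((Fin.cons X v : Fin (r + 2) → M) ∘ Equiv.swap i.succ.castSucc i.succ.succ) =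
            Fin.cons X (v ∘ Equiv.swap i.castSucc i.succ) := by
          funext j
          refine Fin.cases ?_ (fun j => ?_) j
          · simp only [Function.comp_apply]
            rw [Equiv.swap_apply_of_ne_of_ne] <;> simp [Fin.ext_iff]
          · simp only [Function.comp_apply, Fin.castSucc_succ, Fin.cons_succ]
            rw [← Function.Injective.map_swap (Fin.succ_injective _), Fin.cons_succ]
        rw [h, normalProd_cons, normalProd_cons, ih, der_comp_perm _ fun w => ih _ w]

/-- The endomorphism `Y ↦ X * Y - Y * X`. -/
def adj (X : M) : Module.End ℚ M := LinearMap.mulLeft ℚ X - LinearMap.mulRight ℚ X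

theorem adj_apply (X Y : M) : adj X Y = X * Y - Y * X := rfl

/-- The commutator with `ρ X` acts on a normal product factor by factor, as on an ordinary product.
This lets root vectors be moved into a vanishing product of diagonal entries. -/
theorem der_adj_normalProd (hρ : ∀ X Y, ρ X * ρ Y - ρ Y * ρ X = ρ (X * Y - Y * X))
    (r : ℕ) (X : M) (v : Fin r → M) :
    der (adj X) (normalProd ρ r) v = ρ X * normalProd ρ r v - normalProd ρ r v * ρ X := by
  induction r with
  | zero => simp [der_apply, normalProd_zero]
  | succ r ih =>
    induction v using Fin.consCases with | _ Y v =>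
    have key := congrArg (fun F => F v) (der_der_sub (adj X) (lm Y) (normalProd ρ r))
    have h1 : lm Y * adj X - adj X * lm Y = - lm (X * Y - Y * X) := by
      ext; simp [adj, mul_assoc, mul_sub, sub_mul]
    have h3 : der (adj X) (normalProd ρ r) = (lm (ρ X)).compMultilinearMap (normalProd ρ r) -
        (LinearMap.mulRight ℚ (ρ X)).compMultilinearMap (normalProd ρ r) := by
      ext w; exact ih w
    rw [h1, der_neg_left, h3, der_sub_right, der_compMultilinearMap,
      der_compMultilinearMap] at key
    simp only [sub_apply, neg_apply,
      LinearMap.compMultilinearMap_apply, LinearMap.mulLeft_apply,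
      LinearMap.mulRight_apply] at key
    rw [der_cons, curryLeft_normalProd, der_sub_right, der_compMultilinearMap, h3,
      adj_apply, normalProd_cons, normalProd_cons, ← hρ]
    simp only [sub_apply,
      LinearMap.compMultilinearMap_apply, LinearMap.mulLeft_apply,
      LinearMap.mulRight_apply]
    rw [eq_add_of_sub_eq key]
    noncomm_ring

/-- The identity leaves each of the `r` factors unchanged, so the correction term is `r` copies of
the shorter product. -/
theorem normalProd_cons_one {c : ℚ} (h1 : ρ 1 = algebraMap ℚ A c) (r : ℕ) (v : Fin r → M) :
    normalProd ρ (r + 1) (Fin.cons 1 v : Fin (r + 1) → M) = (c - r) • normalProd ρ r v := by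
  have : lm (1 : M) = 1 := by ext; simp
  rw [normalProd_cons, h1, this, der_one, sub_smul, Algebra.smul_def]
  simp

theorem normalProd_one {d : ℕ} (h1 : ρ 1 = algebraMap ℚ A d) (r : ℕ) (hr : r ≤ d) :
    normalProd ρ r (fun _ => 1) = algebraMap ℚ A (d.descFactorial r) := by
  induction r with
  | zero => simp [normalProd_zero]
  | succ r ih =>
    have : (fun _ => 1 : Fin (r + 1) → M) = Fin.cons 1 fun _ => 1 := by
      funext j; refine Fin.cases rfl (fun _ => rfl) j
    rw [this, normalProd_cons_one h1, ih (by omega), Nat.descFactorial_succ, Algebra.smul_def,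
      Nat.cast_mul, Nat.cast_sub (by omega), map_mul]

end NormalOrder


/-! ### Root vectors from the Chevalley–Serre relations -/

section Serre

variable {A : Type*} [Ring A]

attribute [local instance] LieRing.ofAssociativeRing

/-- The iterated commutator `[[e_i, e_{i+1}], …, e_{i+m}]`, the root vector at position
`(i, i + m + 1)`. -/
def posRoot (e : ℕ → A) (i : ℕ) : ℕ → A
  | 0 => e i
  | m + 1 => ⁅posRoot e i m, e (i + m + 1)⁆

/-- The element of position `(i, j)` built from the Chevalley generators. -/
def rootVec (e f h : ℕ → A) (i j : ℕ) : A :=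
  if i < j then posRoot e i (j - i - 1)
  else if i = j then h i
  else -posRoot (-f) j (i - j - 1)

theorem rootVec_pos (e f h : ℕ → A) (i m : ℕ) : rootVec e f h i (i + m + 1) = posRoot e i m := by
  rw [rootVec, if_pos (by omega)]; congr 1; omega

theorem rootVec_self (e f h : ℕ → A) (i : ℕ) : rootVec e f h i i = h i := by
  simp [rootVec]

theorem rootVec_neg (e f h : ℕ → A) (j m : ℕ) :
    rootVec e f h (j + m + 1) j = -posRoot (-f) j m := by
  rw [rootVec, if_neg (by omega), if_neg (by omega)]; congr 2; omega

theorem rootVec_involution (e f h : ℕ → A) (i j : ℕ) :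
    rootVec (-f) (-e) (-h) i j = -rootVec e f h j i := by
  rcases lt_trichotomy i j with hij | rfl | hij
  · obtain ⟨m, rfl⟩ : ∃ m, j = i + m + 1 := ⟨j - i - 1, by omega⟩
    rw [rootVec_pos, rootVec_neg, neg_neg]
  · rw [rootVec_self, rootVec_self, Pi.neg_apply]
  · obtain ⟨m, rfl⟩ : ∃ m, i = j + m + 1 := ⟨i - j - 1, by omega⟩
    rw [rootVec_pos, rootVec_neg, neg_neg]

variable [Algebra ℚ A]

/-- Chevalley-type relations of `𝔤𝔩ₙ` for elements `e_i, f_i` (zero unless `i + 1 < n`) and `h_i`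
of an associative algebra. -/
structure ChevalleyRel (n : ℕ) (e f h : ℕ → A) : Prop where
  hh : ∀ i j, ⁅h i, h j⁆ = 0
  he : ∀ k i, ⁅h k, e i⁆ = ((if k = i then 1 else 0) - (if k = i + 1 then 1 else 0) : ℚ) • e i
  hf : ∀ k i, ⁅h k, f i⁆ = -(((if k = i then 1 else 0) - (if k = i + 1 then 1 else 0) : ℚ) • f i)
  ef : ∀ i j, ⁅e i, f j⁆ = if i = j ∧ i + 1 < n then h i - h (i + 1) else 0
  ee : ∀ i j, i + 1 ≠ j → j + 1 ≠ i → ⁅e i, e j⁆ = 0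
  eee : ∀ i j, i + 1 = j ∨ j + 1 = i → ⁅e i, ⁅e i, e j⁆⁆ = 0
  ff : ∀ i j, i + 1 ≠ j → j + 1 ≠ i → ⁅f i, f j⁆ = 0
  fff : ∀ i j, i + 1 = j ∨ j + 1 = i → ⁅f i, ⁅f i, f j⁆⁆ = 0

/-- The Chevalley involution. -/
theorem ChevalleyRel.neg {n : ℕ} {e f h : ℕ → A} (H : ChevalleyRel n e f h) :
    ChevalleyRel n (-f) (-e) (-h) where
  hh i j := by simp [H.hh]
  he k i := by simp [H.hf]
  hf k i := by simp [H.he]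
  ef i j := by
    rw [Pi.neg_apply, Pi.neg_apply, neg_lie, lie_neg, neg_neg, ← lie_skew, H.ef]
    by_cases hij : i = j
    · subst hij
      split_ifs
      · simp; abel
      · simp
    · rw [if_neg (by tauto), if_neg (by tauto), neg_zero]
  ee i j h1 h2 := by simp [H.ff i j h1 h2]
  eee i j h := by simp [H.fff i j h]
  ff i j h1 h2 := by simp [H.ee i j h1 h2]
  fff i j h := by simp [H.eee i j h]

namespace ChevalleyRel

variable {n : ℕ} {e f h : ℕ → A} (H : ChevalleyRel n e f h)
include H

theorem lie_posRoot_far (k i m : ℕ) (hk : i + m + 1 < k ∨ k + 1 < i) :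
    ⁅e k, posRoot e i m⁆ = 0 := by
  induction m with
  | zero => exact H.ee _ _ (by omega) (by omega)
  | succ m ih =>
    rw [posRoot, leibniz_lie, ih (by omega), H.ee _ _ (by omega) (by omega)]
    simp

/-- A root vector may also be built from its left end, because `e i` commutes with all generators
past its neighbour. -/
theorem lie_posRoot_succ_left (i m : ℕ) :
    ⁅e i, posRoot e (i + 1) m⁆ = posRoot e i (m + 1) := by
  induction m with
  | zero => rfl
  | succ m ih =>
    rw [posRoot, leibniz_lie, ih, H.ee i (i + 1 + m + 1) (by omega) (by omega), lie_zero, add_zero,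
      posRoot.eq_2 e i (m + 1)]
    congr 2
    omega

theorem lie_posRoot_last (i m : ℕ) : ⁅e (i + m), posRoot e i m⁆ = 0 := by
  induction m generalizing i with
  | zero => exact lie_self _
  | succ m ih =>
    rw [← H.lie_posRoot_succ_left, leibniz_lie]
    cases m with
    | zero =>
      have := H.eee (i + 1) i (Or.inr rfl)
      simp only [posRoot, zero_add, lie_self, lie_zero, add_zero]
      rw [← lie_skew, this, neg_zero]
    | succ m =>
      have := ih (i + 1)
      rw [show i + 1 + (m + 1) = i + (m + 1 + 1) by omega] at this
      rw [this, H.ee _ _ (by omega) (by omega)]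
      simp

theorem lie_posRoot_first (i m : ℕ) : ⁅e i, posRoot e i m⁆ = 0 := by
  induction m with
  | zero => exact lie_self _
  | succ m ih =>
    cases m with
    | zero => exact H.eee _ _ (Or.inl rfl)
    | succ m =>
      rw [posRoot, leibniz_lie, ih, H.ee _ _ (by omega) (by omega)]
      simp

/-- In the base case, with a, b, c the left part, the interior generator and the next one, [b, [[a,
b], c]] is expanded in two ways. The Serre relations and [a, c] = 0 give [[a, b], [b, c]] and its
negative, so twice the element is zero. -/
theorem lie_posRoot_mid (i q s : ℕ) : ⁅e (i + q + 1), posRoot e i (q + 2 + s)⁆ = 0 := by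
  induction s with
  | zero =>
    set a := posRoot e i q with ha
    set b := e (i + q + 1) with hb
    set c := e (i + q + 2) with hc
    have hp : posRoot e i (q + 2 + 0) = ⁅⁅a, b⁆, c⁆ := rfl
    have hac : ⁅a, c⁆ = 0 := by
      rw [← lie_skew, H.lie_posRoot_far _ _ _ (by omega), neg_zero]
    have hba : ⁅b, ⁅a, b⁆⁆ = 0 := H.lie_posRoot_last i (q + 1)
    have hbc : ⁅b, ⁅b, c⁆⁆ = 0 := H.eee _ _ (Or.inl rfl)
    have h1 : ⁅b, ⁅⁅a, b⁆, c⁆⁆ = ⁅⁅a, b⁆, ⁅b, c⁆⁆ := by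
      rw [leibniz_lie, hba]; simp
    have h2 : ⁅b, ⁅⁅a, b⁆, c⁆⁆ = -⁅⁅a, b⁆, ⁅b, c⁆⁆ := by
      have : ⁅⁅a, b⁆, c⁆ = ⁅a, ⁅b, c⁆⁆ := by
        rw [leibniz_lie a b c, hac]; simp
      rw [this, leibniz_lie, hbc, lie_zero, add_zero, ← lie_skew b a, neg_lie]
    rw [hp]
    rw [← h1] at h2
    have h3 : (2 : ℚ) • ⁅b, ⁅⁅a, b⁆, c⁆⁆ = 0 := by
      rw [two_smul]; exact eq_neg_iff_add_eq_zero.1 h2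
    exact (smul_eq_zero.1 h3).resolve_left two_ne_zero
  | succ s ih =>
    rw [← add_assoc, posRoot, leibniz_lie, ih, H.ee _ _ (by omega) (by omega)]
    simp

theorem e_lie_posRoot (k i m : ℕ) : ⁅e k, posRoot e i m⁆ =
    (if k + 1 = i then posRoot e k (m + 1) else 0) -
      (if i + m + 1 = k then posRoot e i (m + 1) else 0) := by
  by_cases h1 : k + 1 = i
  · subst h1
    rw [if_pos rfl, if_neg (by omega), H.lie_posRoot_succ_left, sub_zero]
  by_cases h2 : i + m + 1 = k
  · subst h2
    rw [if_neg h1, if_pos rfl, zero_sub, ← lie_skew]; rfl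
  rw [if_neg h1, if_neg h2, sub_zero]
  by_cases h3 : i + m + 1 < k ∨ k + 1 < i
  · exact H.lie_posRoot_far _ _ _ h3
  by_cases h4 : k = i
  · subst h4; exact H.lie_posRoot_first _ _
  by_cases h5 : k = i + m
  · subst h5; exact H.lie_posRoot_last _ _
  obtain ⟨q, rfl⟩ : ∃ q, k = i + q + 1 := ⟨k - i - 1, by omega⟩
  obtain ⟨s, rfl⟩ : ∃ s, m = q + 2 + s := ⟨m - q - 2, by omega⟩
  exact H.lie_posRoot_mid _ _ _

theorem h_lie_posRoot (k i m : ℕ) : ⁅h k, posRoot e i m⁆ =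
    ((if k = i then 1 else 0) - (if k = i + m + 1 then 1 else 0) : ℚ) • posRoot e i m := by
  induction m with
  | zero => exact H.he _ _
  | succ m ih =>
    rw [posRoot, leibniz_lie, ih, H.he, smul_lie, lie_smul, ← add_smul]
    congr 1
    simp only [← add_assoc]
    ring

theorem f_lie_posRoot_zero (k i : ℕ) (hi : i + 1 < n) :
    ⁅f k, posRoot e i 0⁆ = if k = i then h (i + 1) - h i else 0 := by
  rw [posRoot, ← lie_skew, H.ef]
  by_cases hk : i = k
  · subst hk; simp [hi]
  · simp [hk, Ne.symm hk]

theorem f_lie_posRoot_succ (k i m : ℕ) (hi : i + m + 2 < n) : ⁅f k, posRoot e i (m + 1)⁆ =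
    (if k = i then posRoot e (i + 1) m else 0) -
      (if k = i + m + 1 then posRoot e i m else 0) := by
  have hfe (j : ℕ) (hj : j + 1 < n) : ⁅f k, e j⁆ = if k = j then h (j + 1) - h j else 0 :=
    H.f_lie_posRoot_zero k j hj
  have h0 : ⁅posRoot e i m, ⁅f k, e (i + m + 1)⁆⁆ =
      -(if k = i + m + 1 then posRoot e i m else 0) := by
    rw [hfe _ (by omega)]
    by_cases hk : k = i + m + 1
    · rw [if_pos hk, if_pos hk, ← lie_skew, sub_lie, H.h_lie_posRoot, H.h_lie_posRoot, ← sub_smul,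
        if_neg (by omega), if_neg (by omega), if_neg (by omega), if_pos rfl]
      simp
    · simp [hk]
  rw [posRoot, leibniz_lie, h0, ← sub_eq_add_neg]
  congr 1
  -- What remains is the part of the Leibniz expansion where `f k` acts inside the shorter root
  -- vector; it can only strip the left end.
  clear h0
  induction m with
  | zero =>
    rw [posRoot, hfe _ (by omega)]
    by_cases hk : k = i
    · rw [if_pos hk, if_pos hk, sub_lie, H.he, H.he, ← sub_smul]
      rw [if_pos (by omega), if_neg (by omega), if_neg (by omega), if_neg (by omega)]
      simp [posRoot]
    · simp [hk]
  | succ m ih =>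
    rw [posRoot, leibniz_lie, ih (by omega), hfe _ (by omega)]
    have h1 : ⁅posRoot e i m, (if k = i + m + 1 then h (i + m + 1 + 1) - h (i + m + 1) else 0)⁆ =
        -(if k = i + m + 1 then posRoot e i m else 0) := by
      by_cases hk : k = i + m + 1
      · rw [if_pos hk, if_pos hk, ← lie_skew, sub_lie, H.h_lie_posRoot, H.h_lie_posRoot, ← sub_smul,
          if_neg (by omega), if_neg (by omega), if_neg (by omega), if_pos rfl]
        simp
      · simp [hk]
    have h2 : ⁅posRoot e i m, e (i + (m + 1) + 1)⁆ = 0 := by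
      rw [← lie_skew, H.lie_posRoot_far _ _ _ (by omega), neg_zero]
    rw [h1, add_lie, neg_lie]
    split_ifs with hk hk' hk'
    · omega
    · rw [zero_lie, neg_zero, add_zero, posRoot, show i + 1 + m + 1 = i + (m + 1) + 1 by omega]
    · rw [h2]; simp
    · simp

end ChevalleyRel

namespace ChevalleyRel

variable {n : ℕ} {e f h : ℕ → A} (H : ChevalleyRel n e f h)
include H

/-- These are the matrix brackets [E_{k,k+1}, E_{ij}]. For i > j the Chevalley involution turns them
into brackets of some `f` with a positive root vector. -/
theorem e_lie_rootVec (k i j : ℕ) (hk : k + 1 < n) (hi : i < n) (hj : j < n) :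
    ⁅e k, rootVec e f h i j⁆ =
      (if k + 1 = i then rootVec e f h k j else 0) -
        (if j = k then rootVec e f h i (k + 1) else 0) := by
  rcases lt_trichotomy i j with hij | rfl | hij
  · obtain ⟨m, rfl⟩ : ∃ m, j = i + m + 1 := ⟨j - i - 1, by omega⟩
    rw [rootVec_pos, H.e_lie_posRoot]
    congr 1
    · split_ifs with h1
      · subst h1
        rw [show k + 1 + m + 1 = k + (m + 1) + 1 by omega, rootVec_pos]
      · rfl
    · split_ifs with h1
      · subst h1
        rw [show i + m + 1 + 1 = i + (m + 1) + 1 by omega, rootVec_pos]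
      · rfl
  · rw [rootVec_self, ← lie_skew, H.he]
    by_cases h1 : i = k
    · subst h1
      have := rootVec_pos e f h i 0
      rw [add_zero] at this
      simp [this, posRoot]
    · by_cases h2 : k + 1 = i
      · subst h2
        have := rootVec_pos e f h k 0
        rw [add_zero] at this
        simp [this, posRoot]
      · simp [h1, h2, Ne.symm h2]
  · obtain ⟨m, rfl⟩ : ∃ m, i = j + m + 1 := ⟨i - j - 1, by omega⟩
    rw [rootVec_neg, lie_neg, ← neg_lie]
    cases m with
    | zero =>
      have := H.neg.f_lie_posRoot_zero k j (by omega)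
      rw [Pi.neg_apply] at this
      rw [this]
      by_cases h1 : k = j
      · subst h1
        simp only [if_true, add_zero, rootVec_self, Pi.neg_apply]
        abel
      · rw [if_neg h1, if_neg (by omega), if_neg (by omega), sub_zero]
    | succ m =>
      have := H.neg.f_lie_posRoot_succ k j m (by omega)
      rw [Pi.neg_apply] at this
      rw [this]
      have h1 : (if k + 1 = j + (m + 1) + 1 then rootVec e f h k j else 0) =
          -(if k = j + m + 1 then posRoot (-f) j m else 0) := by
        split_ifs with h1 h2 h2
        · subst h2; rw [rootVec_neg]
        · omega
        · omega
        · simp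
      have h2 : (if j = k then rootVec e f h (j + (m + 1) + 1) (k + 1) else 0) =
          -(if k = j then posRoot (-f) (j + 1) m else 0) := by
        by_cases h2 : j = k
        · subst h2
          rw [if_pos rfl, if_pos rfl, show j + (m + 1) + 1 = j + 1 + m + 1 by omega, rootVec_neg]
        · simp [h2, Ne.symm h2]
      rw [h1, h2]
      abel

theorem f_lie_rootVec (k i j : ℕ) (hk : k + 1 < n) (hi : i < n) (hj : j < n) :
    ⁅f k, rootVec e f h i j⁆ =
      (if k = i then rootVec e f h (k + 1) j else 0) -
        (if j = k + 1 then rootVec e f h i k else 0) := by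
  have := H.neg.e_lie_rootVec k j i hk hj hi
  simp only [rootVec_involution, Pi.neg_apply, neg_lie, lie_neg, neg_neg] at this
  rw [this]
  simp only [eq_comm (a := k), eq_comm (a := j)]
  split_ifs <;> simp [add_comm, sub_eq_add_neg]

theorem h_lie_rootVec (k i j : ℕ) : ⁅h k, rootVec e f h i j⁆ =
    ((if k = i then 1 else 0) - (if k = j then 1 else 0) : ℚ) • rootVec e f h i j := by
  rcases lt_trichotomy i j with hij | rfl | hij
  · obtain ⟨m, rfl⟩ : ∃ m, j = i + m + 1 := ⟨j - i - 1, by omega⟩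
    rw [rootVec_pos, H.h_lie_posRoot]
  · rw [rootVec_self, H.hh]; simp
  · obtain ⟨m, rfl⟩ : ∃ m, i = j + m + 1 := ⟨i - j - 1, by omega⟩
    have := H.neg.h_lie_posRoot k j m
    rw [Pi.neg_apply, neg_lie] at this
    rw [rootVec_neg, lie_neg, this, smul_neg, ← neg_smul, neg_sub]

end ChevalleyRel

end Serre


/-! ### Matrix units as generators of 𝔤𝔩ₙ -/

section Matrices

/-- Square matrices over `ℚ`. -/
abbrev Mat (n : ℕ) : Type := Matrix (Fin n) (Fin n) ℚ

/-- The matrix unit at position `(i, j)`. -/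
abbrev unit {n : ℕ} (i j : Fin n) : Mat n := Matrix.single i j 1

theorem unit_mul_unit {n : ℕ} (i j k l : Fin n) :
    unit i j * unit k l = if j = k then unit i l else 0 := by
  split_ifs with h
  · subst h; simp
  · simp [h]

theorem unit_mul_diagonal_sub {n : ℕ} (i j : Fin n) (c : Fin n → ℚ) :
    unit i j * Matrix.diagonal c - Matrix.diagonal c * unit i j = (c j - c i) • unit i j := by
  ext p q
  simp only [Matrix.sub_apply, Matrix.mul_diagonal, Matrix.diagonal_mul, Matrix.smul_apply,
    Matrix.single_apply]
  split_ifs with h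
  · rw [← h.1, ← h.2]; simp
  · simp

theorem mat_induction {n : ℕ} {S : Submodule ℚ (Mat n)} (h : ∀ i j, unit i j ∈ S) (X : Mat n) :
    X ∈ S := by
  induction X using Matrix.induction_on' with
  | h_zero => exact S.zero_mem
  | h_add p q hp hq => exact S.add_mem hp hq
  | h_std_basis i j x =>
    have : Matrix.single i j x = x • unit i j := by simp
    rw [this]
    exact S.smul_mem _ (h i j)

/-- `𝔤𝔩ₙ` is generated as a Lie algebra by the `E_{i,i+1}`, `E_{i+1,i}` and `E_{k,k}`. -/
theorem mem_of_bracket_closed {n : ℕ} {S : Submodule ℚ (Mat n)}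
    (hS : ∀ X ∈ S, ∀ Y ∈ S, X * Y - Y * X ∈ S)
    (hE : ∀ i : Fin (n - 1), unit (idx i) (idxSucc i) ∈ S)
    (hF : ∀ i : Fin (n - 1), unit (idxSucc i) (idx i) ∈ S)
    (hH : ∀ k, unit k k ∈ S) (X : Mat n) : X ∈ S := by
  have hpos (m : ℕ) : ∀ i j : Fin n, (j : ℕ) = i + m + 1 → unit i j ∈ S ∧ unit j i ∈ S := by
    induction m with
    | zero =>
      intro i j hij
      have hi : (i : ℕ) < n - 1 := by omega
      have h1 : i = idx ⟨i, hi⟩ := rfl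
      have h2 : j = idxSucc ⟨i, hi⟩ := Fin.ext hij
      rw [h1, h2]
      exact ⟨hE _, hF _⟩
    | succ m ih =>
      intro i j hij
      have hi : (i : ℕ) + m + 1 < n - 1 := by omega
      have h1 := ih i (idx ⟨_, hi⟩) rfl
      have h2 : j = idxSucc ⟨_, hi⟩ := Fin.ext hij
      have h3 : idxSucc ⟨_, hi⟩ ≠ i := fun h => by
        have := congrArg Fin.val h
        simp [idxSucc] at this
        omega
      rw [h2]
      constructor
      · have := hS _ h1.1 _ (hE ⟨_, hi⟩)
        rwa [unit_mul_unit, unit_mul_unit, if_pos rfl, if_neg h3, sub_zero] at this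
      · have := hS _ (hF ⟨_, hi⟩) _ h1.2
        rwa [unit_mul_unit, unit_mul_unit, if_pos rfl, if_neg h3.symm, sub_zero] at this
  refine mat_induction (fun i j => ?_) X
  rcases lt_trichotomy i j with h | rfl | h
  · exact (hpos (j - i - 1) i j (by omega)).1
  · exact hH i
  · exact (hpos (i - j - 1) j i (by omega)).2

end Matrices

/-! ### The Lie homomorphism and the vanishing of normal products -/

section Representation

variable {A : Type*} [Ring A] [Algebra ℚ A]

/-- The linear map on matrices sending matrix units to the elements `rootVec`. -/
def rho (n : ℕ) (e f h : ℕ → A) : Mat n →ₗ[ℚ] A :=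
  ∑ i : Fin n, ∑ j : Fin n, (Matrix.entryLinearMap ℚ ℚ i j).smulRight (rootVec e f h i j)

theorem rho_unit {n : ℕ} (e f h : ℕ → A) (i j : Fin n) :
    rho n e f h (unit i j) = rootVec e f h i j := by
  rw [rho, LinearMap.sum_apply, Finset.sum_eq_single i, LinearMap.sum_apply,
    Finset.sum_eq_single j]
  · simp
  · intro k _ hk
    simp [hk.symm]
  · simp
  · intro k _ hk
    simp [hk.symm]
  · simp

theorem bracket_of_unit {n : ℕ} {ρ : Mat n →ₗ[ℚ] A} {X : Mat n}
    (h : ∀ i j, ρ X * ρ (unit i j) - ρ (unit i j) * ρ X = ρ (X * unit i j - unit i j * X))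
    (Y : Mat n) : ρ X * ρ Y - ρ Y * ρ X = ρ (X * Y - Y * X) :=
  mat_induction (S := LinearMap.eqLocus (adj (ρ X) ∘ₗ ρ) (ρ ∘ₗ adj X)) h Y

/-- By the Jacobi identity, the matrices `X` that bracket correctly with every `Y` form a Lie
subalgebra. So brackets between two arbitrary root vectors never have to be computed. -/
theorem bracket_of_generators {n : ℕ} {ρ : Mat n →ₗ[ℚ] A}
    (hE : ∀ i : Fin (n - 1), ∀ Y, ρ (unit (idx i) (idxSucc i)) * ρ Y -
      ρ Y * ρ (unit (idx i) (idxSucc i)) =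
        ρ (unit (idx i) (idxSucc i) * Y - Y * unit (idx i) (idxSucc i)))
    (hF : ∀ i : Fin (n - 1), ∀ Y, ρ (unit (idxSucc i) (idx i)) * ρ Y -
      ρ Y * ρ (unit (idxSucc i) (idx i)) =
        ρ (unit (idxSucc i) (idx i) * Y - Y * unit (idxSucc i) (idx i)))
    (hH : ∀ k : Fin n, ∀ Y, ρ (unit k k) * ρ Y - ρ Y * ρ (unit k k) =
        ρ (unit k k * Y - Y * unit k k)) (X Y : Mat n) :
    ρ X * ρ Y - ρ Y * ρ X = ρ (X * Y - Y * X) := by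
  let S : Submodule ℚ (Mat n) :=
    { carrier := {X | ∀ Y, ρ X * ρ Y - ρ Y * ρ X = ρ (X * Y - Y * X)}
      zero_mem' := by simp
      add_mem' := fun {X X'} hX hX' Y => by
        have h : (X + X') * Y - Y * (X + X') = (X * Y - Y * X) + (X' * Y - Y * X') := by
          noncomm_ring
        rw [h, map_add ρ (X * Y - Y * X), ← hX, ← hX', map_add]
        noncomm_ring
      smul_mem' := fun c X hX Y => by
        have h : (c • X) * Y - Y * (c • X) = c • (X * Y - Y * X) := by
          simp [smul_sub]
        rw [h, map_smul ρ c (_ - _), ← hX, map_smul]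
        simp [smul_sub] }
  refine mem_of_bracket_closed (S := S) (fun X hX X' hX' Y => ?_) hE hF hH X Y
  have h : (X * X' - X' * X) * Y - Y * (X * X' - X' * X) =
      (X * (X' * Y - Y * X') - (X' * Y - Y * X') * X) -
        (X' * (X * Y - Y * X) - (X * Y - Y * X) * X') := by
    noncomm_ring
  rw [h, map_sub ρ (_ - _) (_ - _), ← hX, ← hX', ← hX, ← hX', ← hX]
  noncomm_ring

theorem rho_bracket {n : ℕ} {e f h : ℕ → A} (H : ChevalleyRel n e f h) (X Y : Mat n) :
    rho n e f h X * rho n e f h Y - rho n e f h Y * rho n e f h X =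
      rho n e f h (X * Y - Y * X) := by
  have hs (P : Prop) [Decidable P] (a b : Fin n) :
      rho n e f h (if P then unit a b else 0) = if P then rootVec e f h a b else 0 := by
    split_ifs
    · rw [rho_unit]
    · simp
  refine bracket_of_generators (fun k => bracket_of_unit fun i j => ?_)
    (fun k => bracket_of_unit fun i j => ?_) (fun k => bracket_of_unit fun i j => ?_) X Y
  · have h1 := H.e_lie_rootVec k i j (by omega) i.2 j.2
    have h2 : rootVec e f h (idx k : Fin n) (idxSucc k : Fin n) = e k :=
      rootVec_pos e f h k 0
    rw [map_sub, unit_mul_unit, unit_mul_unit, hs, hs, rho_unit, rho_unit, h2]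
    simp only [Fin.ext_iff]
    exact h1
  · have h1 := H.f_lie_rootVec k i j (by omega) i.2 j.2
    have h2 : rootVec e f h (idxSucc k : Fin n) (idx k : Fin n) = f k := by
      have := rootVec_neg e f h k 0
      rwa [posRoot, Pi.neg_apply, neg_neg] at this
    rw [map_sub, unit_mul_unit, unit_mul_unit, hs, hs, rho_unit, rho_unit, h2]
    simp only [Fin.ext_iff]
    exact h1
  · have h1 := H.h_lie_rootVec k i j
    rw [map_sub, unit_mul_unit, unit_mul_unit, hs, hs, rho_unit, rho_unit, rootVec_self]
    refine Eq.trans h1 ?_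
    rw [sub_smul, ite_smul, ite_smul, one_smul, zero_smul]
    simp only [Fin.ext_iff, eq_comm (a := (j : ℕ))]
    congr 1
    · split_ifs with h3
      · rw [h3]
      · rfl
    · split_ifs with h3
      · rw [h3]
      · rfl

/-- If normally ordered products of diagonal matrix units of length `r` vanish, then all normally
ordered products of length `r` vanish. -/
theorem normalProd_eq_zero {n : ℕ} {ρ : Mat n →ₗ[ℚ] A}
    (hρ : ∀ X Y, ρ X * ρ Y - ρ Y * ρ X = ρ (X * Y - Y * X)) {r : ℕ}
    (hdiag : ∀ w : Fin r → Fin n, normalProd ρ r (fun t => unit (w t) (w t)) = 0)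
    (v : Fin r → Mat n) : normalProd ρ r v = 0 := by
  set F := normalProd ρ r with hF
  -- `O` is the set of positions where a non-diagonal entry is allowed; it grows one position at a
  -- time.
  suffices h : ∀ O : Finset (Fin r), ∀ v : Fin r → Mat n,
      (∀ t ∉ O, ∃ c, v t = Matrix.diagonal c) → F v = 0 from
    h Finset.univ v fun t ht => absurd (Finset.mem_univ t) ht
  intro O
  induction O using Finset.induction_on with
  | empty =>
    intro v hv
    choose c hc using fun t => hv t (Finset.notMem_empty t)
    have h1 : v = fun t => ∑ k, c t k • unit k k := by
      funext t
      rw [hc t, ← Matrix.sum_single_eq_diagonal]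
      simp
    rw [h1, MultilinearMap.map_sum]
    refine Finset.sum_eq_zero fun w _ => ?_
    rw [MultilinearMap.map_smul_univ F (fun t => c t (w t)), hdiag, smul_zero]
  | insert a O ha ih =>
    intro v hv
    -- Put E_jj at `a` and take the commutator with ρ(E_ij): the result is zero by induction.
    -- Expanded as a derivation, it is a positive multiple of `F u`. Position `a` gives `F u`,
    -- positions in `O` give zero by induction, and any other gives zero or, by symmetry of `F`,
    -- another copy of `F u`.
    have main (i j : Fin n) (hij : i ≠ j) (u : Fin r → Mat n) (hua : u a = unit i j)
        (hu : ∀ t ∉ insert a O, (∃ c, u t = Matrix.diagonal c) ∧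
          (unit i j * u t - u t * unit i j = 0 ∨ ∃ x : ℚ, u t = x • unit j j)) : F u = 0 := by
      set u' := Function.update u a (unit j j) with hu'
      have hdiag' : ∀ t ∉ O, ∃ c, u' t = Matrix.diagonal c := by
        intro t ht
        by_cases hta : t = a
        · subst hta
          exact ⟨Pi.single j 1, by rw [hu', Function.update_self, Matrix.diagonal_single]⟩
        · rw [hu', Function.update_of_ne hta]
          exact (hu t (by simp [hta, ht])).1
      have h1 := der_adj_normalProd hρ r (unit i j) u'
      rw [← hF, ih u' hdiag', mul_zero, zero_mul, sub_zero, der_apply] at h1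
      have h2 : ∀ t, ∃ m : ℕ, F (Function.update u' t (adj (unit i j) (u' t))) = m • F u ∧
          (t = a → m = 1) := by
        intro t
        by_cases hta : t = a
        · subst hta
          refine ⟨1, ?_, fun _ => rfl⟩
          rw [hu', Function.update_self, Function.update_idem, adj_apply, unit_mul_unit,
            unit_mul_unit, if_pos rfl, if_neg hij.symm, sub_zero, ← hua, Function.update_eq_self,
            one_smul]
        by_cases htO : t ∈ O
        · refine ⟨0, ?_, fun h => absurd h hta⟩
          rw [zero_smul]
          refine ih _ fun s hs => ?_
          rw [Function.update_of_ne (ne_of_mem_of_not_mem htO hs).symm]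
          exact hdiag' s hs
        have hut : u' t = u t := by rw [hu', Function.update_of_ne hta]
        rcases (hu t (by simp [hta, htO])).2 with hc | ⟨x, hx⟩
        · refine ⟨0, ?_, fun h => absurd h hta⟩
          rw [hut, adj_apply, hc, MultilinearMap.map_update_zero, zero_smul]
        · refine ⟨1, ?_, fun h => absurd h hta⟩
          have h3 : u = Function.update (Function.update u a (unit i j)) t (x • unit j j) := by
            rw [← hx, ← hua]; simp
          rw [hut, hx, map_smul, adj_apply, unit_mul_unit, unit_mul_unit, if_pos rfl,
            if_neg hij.symm, sub_zero, one_smul, MultilinearMap.map_update_smul]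
          conv_rhs => rw [h3, MultilinearMap.map_update_smul,
            ← normalProd_comp_perm hρ r (Equiv.swap a t)]
          congr 2
          funext s
          rw [Function.comp_apply]
          by_cases hsa : s = a
          · subst hsa
            rw [Equiv.swap_apply_left, Function.update_self, Function.update_of_ne (Ne.symm hta),
              hu', Function.update_self]
          by_cases hst : s = t
          · subst hst
            rw [Equiv.swap_apply_right, Function.update_self, Function.update_of_ne (Ne.symm hta),
              Function.update_self]
          rw [Equiv.swap_apply_of_ne_of_ne hsa hst, hu']
          simp [hsa, hst]
      choose m hm hma using h2
      simp only [hm] at h1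
      rw [← Finset.sum_smul, ← Nat.cast_smul_eq_nsmul ℚ] at h1
      refine (smul_eq_zero.1 h1).resolve_left ?_
      rw [← ne_eq, Nat.cast_ne_zero, ← Nat.pos_iff_ne_zero]
      refine lt_of_lt_of_le ?_ (Finset.single_le_sum (fun _ _ => Nat.zero_le _)
        (Finset.mem_univ a))
      rw [hma a rfl]
      exact one_pos
    have key (X : Mat n) : F (Function.update v a X) = 0 := by
      refine mat_induction (S := LinearMap.ker (F.toLinearMap v a)) (fun i j => ?_) X
      rw [LinearMap.mem_ker, MultilinearMap.toLinearMap_apply]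
      by_cases hij : i = j
      · subst hij
        refine ih _ fun t ht => ?_
        by_cases hta : t = a
        · subst hta
          exact ⟨Pi.single i 1, by rw [Function.update_self, Matrix.diagonal_single]⟩
        · rw [Function.update_of_ne hta]
          exact hv t (by simp [hta, ht])
      choose! c hc using hv
      -- Each diagonal entry D splits as (D - g) + g, with D - g commuting with E_ij and g a
      -- multiple of E_jj: the two cases that `main` allows.
      set g : Fin r → Mat n := fun t =>
        if t ∈ insert a O then 0 else (c t j - c t i) • unit j j with hg
      have h1 : Function.update v a (unit i j) = (Function.update v a (unit i j) - g) + g := by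
        abel
      rw [h1, MultilinearMap.map_add_univ]
      refine Finset.sum_eq_zero fun s _ => ?_
      have hga : g a = 0 := by simp [hg]
      by_cases has : a ∈ s
      · refine main i j hij _ (by simp [has, hga]) fun t ht => ?_
        have hta : t ≠ a := fun h => ht (by simp [h])
        have hgt : g t = (c t j - c t i) • unit j j := if_neg ht
        have hgt' : g t = Matrix.diagonal (Pi.single j (c t j - c t i)) := by
          rw [hgt, Matrix.diagonal_single]; simp
        by_cases hts : t ∈ s
        · rw [Finset.piecewise_eq_of_mem _ _ _ hts, Pi.sub_apply, Function.update_of_ne hta, hc t ht]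
          refine ⟨⟨_, by rw [hgt', Matrix.diagonal_sub]⟩, Or.inl ?_⟩
          rw [hgt', Matrix.diagonal_sub, unit_mul_diagonal_sub]
          simp [hij]
        · rw [Finset.piecewise_eq_of_notMem _ _ _ hts]
          exact ⟨⟨_, hgt'⟩, Or.inr ⟨_, hgt⟩⟩
      · exact F.map_coord_zero a (by simp [has, hga])
    rw [← Function.update_eq_self a v]
    exact key _

end Representation


/-! ### The Lie homomorphism into the presented algebra -/

section Presented

theorem neg_smul_eq {A : Type*} [Ring A] [Algebra ℚ A] (c : ℚ) (x : A) :
    (-c) • x = -(c • x) :=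
  neg_smul c x

variable {n d : ℕ}

theorem toPresented_rel {a b : Free n d} (h : Rel n d a b) :
    toPresented n d a = toPresented n d b :=
  RingQuot.mkAlgHom_rel ℚ h

variable (n d) in
/-- Linear combinations of the idempotents `1_λ`, as an algebra homomorphism on functions of
`λ`. -/
def cartan : (Lam n d → ℚ) →ₐ[ℚ] Presented n d :=
  AlgHom.ofLinearMap
    (∑ l : Lam n d, (LinearMap.proj l : (Lam n d → ℚ) →ₗ[ℚ] ℚ).smulRight (toPresented n d (gOne l)))
    (by
      simp only [LinearMap.sum_apply, LinearMap.smulRight_apply, LinearMap.proj_apply,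
        Pi.one_apply, one_smul]
      rw [← map_sum, toPresented_rel Rel.sum_one, map_one])
    (by
      intro c c'
      simp only [LinearMap.sum_apply, LinearMap.smulRight_apply, LinearMap.proj_apply,
        Pi.mul_apply]
      rw [Finset.sum_mul_sum]
      refine Finset.sum_congr rfl fun l _ => ?_
      rw [Finset.sum_eq_single l]
      · rw [smul_mul_smul_comm, ← map_mul, toPresented_rel (Rel.one_mul_one l l), if_pos rfl]
      · intro m _ hm
        rw [smul_mul_smul_comm, ← map_mul, toPresented_rel (Rel.one_mul_one l m),
          if_neg hm.symm, map_zero, smul_zero]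
      · simp)

theorem cartan_apply (c : Lam n d → ℚ) :
    cartan n d c = ∑ l, c l • toPresented n d (gOne l) := by
  change (∑ l : Lam n d, (LinearMap.proj l : (Lam n d → ℚ) →ₗ[ℚ] ℚ).smulRight
    (toPresented n d (gOne l))) c = _
  simp

theorem cartan_single (l : Lam n d) : cartan n d (Pi.single l 1) = toPresented n d (gOne l) := by
  rw [cartan_apply, Finset.sum_eq_single l]
  · simp
  · intro m _ hm; simp [hm]
  · simp

theorem cartan_mul_one (c : Lam n d → ℚ) (l : Lam n d) :
    cartan n d c * toPresented n d (gOne l) = c l • toPresented n d (gOne l) := by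
  rw [← cartan_single, ← map_mul, ← map_smul]
  congr 1
  ext m
  by_cases h : m = l
  · subst h; simp
  · simp [h]

theorem eq_of_mul_one {x y : Presented n d}
    (h : ∀ l, x * toPresented n d (gOne l) = y * toPresented n d (gOne l)) : x = y := by
  have h1 : ∑ l, toPresented n d (gOne l) = 1 := by
    rw [← map_sum, toPresented_rel Rel.sum_one, map_one]
  rw [← mul_one x, ← mul_one y, ← h1, Finset.mul_sum, Finset.mul_sum]
  exact Finset.sum_congr rfl fun l _ => h l

/-- `e_i` shifts weights by α_i, so its commutator with a function of λ is scalar when the function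
changes by a constant under that shift. When λ + α_i is not a composition, both products with 1_λ
vanish. -/
theorem cartan_mul_e (i : Fin (n - 1)) {c : Lam n d → ℚ} {a : ℚ}
    (hc : ∀ l m : Lam n d, m.toInt = l.toInt + simpleRoot i → c m = c l + a) :
    cartan n d c * toPresented n d (gE d i) - toPresented n d (gE d i) * cartan n d c =
      a • toPresented n d (gE d i) := by
  refine eq_of_mul_one fun l => ?_
  rw [sub_mul, mul_assoc, mul_assoc, cartan_mul_one, smul_mul_assoc, mul_smul_comm, ← map_mul]
  by_cases h : ∃ m : Lam n d, m.toInt = l.toInt + simpleRoot i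
  · obtain ⟨m, hm⟩ := h
    rw [toPresented_rel (Rel.e_one i l m hm), map_mul, ← mul_assoc, cartan_mul_one,
      hc l m hm, smul_mul_assoc, add_smul, add_sub_cancel_left]
  · push Not at h
    rw [toPresented_rel (Rel.e_one_zero i l h)]
    simp

theorem cartan_mul_f (i : Fin (n - 1)) {c : Lam n d → ℚ} {a : ℚ}
    (hc : ∀ l m : Lam n d, m.toInt = l.toInt - simpleRoot i → c m = c l + a) :
    cartan n d c * toPresented n d (gF d i) - toPresented n d (gF d i) * cartan n d c =
      a • toPresented n d (gF d i) := by
  refine eq_of_mul_one fun l => ?_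
  rw [sub_mul, mul_assoc, mul_assoc, cartan_mul_one, smul_mul_assoc, mul_smul_comm, ← map_mul]
  by_cases h : ∃ m : Lam n d, m.toInt = l.toInt - simpleRoot i
  · obtain ⟨m, hm⟩ := h
    rw [toPresented_rel (Rel.f_one i l m hm), map_mul, ← mul_assoc, cartan_mul_one,
      hc l m hm, smul_mul_assoc, add_smul, add_sub_cancel_left]
  · push Not at h
    rw [toPresented_rel (Rel.f_one_zero i l h)]
    simp

variable (n d) in
/-- The `k`-th coordinate as a function on `Λ(n,d)`. -/
def coord (k : Fin n) : Lam n d → ℚ := fun l => l.1 k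

/-- A finite family indexed by `Fin m`, extended by zero to `ℕ`. -/
def extendZero {A : Type*} [Zero A] {m : ℕ} (x : Fin m → A) (k : ℕ) : A :=
  if h : k < m then x ⟨k, h⟩ else 0

theorem extendZero_of_lt {A : Type*} [Zero A] {m : ℕ} (x : Fin m → A) {k : ℕ} (h : k < m) :
    extendZero x k = x ⟨k, h⟩ := dif_pos h

theorem extendZero_of_not_lt {A : Type*} [Zero A] {m : ℕ} (x : Fin m → A) {k : ℕ} (h : ¬ k < m) :
    extendZero x k = 0 := dif_neg h

theorem extendZero_val {A : Type*} [Zero A] {m : ℕ} (x : Fin m → A) (k : Fin m) :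
    extendZero x k = x k := dif_pos k.2

variable (n d) in
/-- The `e_i` of the presented algebra. -/
def presE : ℕ → Presented n d := extendZero fun i => toPresented n d (gE d i)

variable (n d) in
/-- The `f_i` of the presented algebra. -/
def presF : ℕ → Presented n d := extendZero fun i => toPresented n d (gF d i)

variable (n d) in
/-- The `H_k` of the presented algebra. -/
def presH : ℕ → Presented n d := extendZero fun k => cartan n d (coord n d k)

theorem simpleRoot_apply (i : Fin (n - 1)) (k : Fin n) :
    ((simpleRoot i k : ℤ) : ℚ) =
      (if (k : ℕ) = i then 1 else 0) - (if (k : ℕ) = i + 1 then 1 else 0) := by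
  simp [simpleRoot, Pi.single_apply, Fin.ext_iff, idx, idxSucc]

theorem coord_add {i : Fin (n - 1)} (k : Fin n) {l m : Lam n d}
    (h : m.toInt = l.toInt + simpleRoot i) : coord n d k m = coord n d k l +
      ((if (k : ℕ) = i then 1 else 0) - (if (k : ℕ) = i + 1 then 1 else 0)) := by
  have := congrArg (Int.cast : ℤ → ℚ) (congrFun h k)
  rw [Pi.add_apply, Int.cast_add, simpleRoot_apply] at this
  simpa [Lam.toInt, coord] using this

theorem coord_sub {i : Fin (n - 1)} (k : Fin n) {l m : Lam n d}
    (h : m.toInt = l.toInt - simpleRoot i) : coord n d k m = coord n d k l +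
      -((if (k : ℕ) = i then 1 else 0) - (if (k : ℕ) = i + 1 then 1 else 0)) := by
  have := congrArg (Int.cast : ℤ → ℚ) (congrFun h k)
  rw [Pi.sub_apply, Int.cast_sub, simpleRoot_apply] at this
  rw [← sub_eq_add_neg]
  simpa only [Lam.toInt, coord, Int.cast_natCast] using this

theorem commutator_commutator {A : Type*} [Ring A] (x y : A) :
    x * (x * y - y * x) - (x * y - y * x) * x = x ^ 2 * y - 2 * x * y * x + y * x ^ 2 := by
  noncomm_ring

attribute [local instance] LieRing.ofAssociativeRing in
theorem serre_lie {A : Type*} [Ring A] (x y : A) :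
    ⁅x, ⁅x, y⁆⁆ = x ^ 2 * y - 2 * x * y * x + y * x ^ 2 :=
  commutator_commutator x y

attribute [local instance] LieRing.ofAssociativeRing in
variable (n d) in
theorem presented_chevalleyRel : ChevalleyRel n (presE n d) (presF n d) (presH n d) where
  hh i j := by
    by_cases hi : i < n
    · by_cases hj : j < n
      · rw [presH, extendZero_of_lt _ hi, extendZero_of_lt _ hj]
        change _ * _ - _ * _ = _
        rw [← map_mul, ← map_mul, mul_comm, sub_self]
      · rw [presH, extendZero_of_not_lt _ hj, lie_zero]
    · rw [presH, extendZero_of_not_lt _ hi, zero_lie]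
  he k i := by
    by_cases hi : i < n - 1
    · by_cases hk : k < n
      · rw [presH, presE, extendZero_of_lt _ hi, extendZero_of_lt _ hk]
        exact cartan_mul_e ⟨i, hi⟩ fun l m h => coord_add ⟨k, hk⟩ h
      · rw [presH, extendZero_of_not_lt _ hk, zero_lie, if_neg (by omega), if_neg (by omega),
          sub_zero, zero_smul]
    · rw [presE, extendZero_of_not_lt _ hi, lie_zero, smul_zero]
  hf k i := by
    by_cases hi : i < n - 1
    · by_cases hk : k < n
      · rw [presH, presF, extendZero_of_lt _ hi, extendZero_of_lt _ hk]
        exact (cartan_mul_f ⟨i, hi⟩ fun l m h => coord_sub ⟨k, hk⟩ h).trans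
          (neg_smul_eq (A := Presented n d) _ _)
      · rw [presH, extendZero_of_not_lt _ hk, zero_lie, if_neg (by omega), if_neg (by omega),
          sub_zero, zero_smul, neg_zero]
    · rw [presF, extendZero_of_not_lt _ hi, lie_zero, smul_zero, neg_zero]
  ef i j := by
    by_cases hi : i < n - 1
    · by_cases hj : j < n - 1
      · rw [presE, presF, extendZero_of_lt _ hi, extendZero_of_lt _ hj]
        have h1 := toPresented_rel (Rel.e_f (d := d) ⟨i, hi⟩ ⟨j, hj⟩)
        rw [map_sub, map_mul, map_mul] at h1
        refine Eq.trans h1 ?_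
        by_cases hij : i = j
        · subst hij
          rw [if_pos rfl, if_pos ⟨rfl, by omega⟩, presH, extendZero_of_lt _ (by omega : i < n),
            extendZero_of_lt _ (by omega : i + 1 < n), ← map_sub, cartan_apply, map_sum]
          refine Finset.sum_congr rfl fun l _ => ?_
          rw [map_smul]; rfl
        · rw [if_neg (by simpa using hij), if_neg (by tauto), map_zero]
      · rw [presF, extendZero_of_not_lt _ hj, lie_zero, if_neg (by omega)]
    · rw [presE, extendZero_of_not_lt _ hi, zero_lie, if_neg (by omega)]
  ee i j h1 h2 := by
    by_cases hi : i < n - 1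
    · by_cases hj : j < n - 1
      · rw [presE, extendZero_of_lt _ hi, extendZero_of_lt _ hj]
        have h := toPresented_rel (Rel.comm_e (d := d) ⟨i, hi⟩ ⟨j, hj⟩
          (by simp only [ne_eq, abs_eq (zero_le_one (α := ℤ))]; omega))
        rwa [map_sub, map_mul, map_mul, map_zero] at h
      · rw [presE, extendZero_of_not_lt _ hj, lie_zero]
    · rw [presE, extendZero_of_not_lt _ hi, zero_lie]
  eee i j h := by
    by_cases hi : i < n - 1
    · by_cases hj : j < n - 1
      · rw [presE, extendZero_of_lt _ hi, extendZero_of_lt _ hj, serre_lie]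
        have h := toPresented_rel (Rel.serre_e (d := d) ⟨i, hi⟩ ⟨j, hj⟩
          (by simp only [abs_eq (zero_le_one (α := ℤ))]; omega))
        simpa only [map_add, map_sub, map_mul, map_pow, map_zero, map_ofNat] using h
      · rw [presE, extendZero_of_not_lt _ hj, lie_zero, lie_zero]
    · rw [presE, extendZero_of_not_lt _ hi, zero_lie]
  ff i j h1 h2 := by
    by_cases hi : i < n - 1
    · by_cases hj : j < n - 1
      · rw [presF, extendZero_of_lt _ hi, extendZero_of_lt _ hj]
        have h := toPresented_rel (Rel.comm_f (d := d) ⟨i, hi⟩ ⟨j, hj⟩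
          (by simp only [ne_eq, abs_eq (zero_le_one (α := ℤ))]; omega))
        rwa [map_sub, map_mul, map_mul, map_zero] at h
      · rw [presF, extendZero_of_not_lt _ hj, lie_zero]
    · rw [presF, extendZero_of_not_lt _ hi, zero_lie]
  fff i j h := by
    by_cases hi : i < n - 1
    · by_cases hj : j < n - 1
      · rw [presF, extendZero_of_lt _ hi, extendZero_of_lt _ hj, serre_lie]
        have h := toPresented_rel (Rel.serre_f (d := d) ⟨i, hi⟩ ⟨j, hj⟩
          (by simp only [abs_eq (zero_le_one (α := ℤ))]; omega))
        simpa only [map_add, map_sub, map_mul, map_pow, map_zero, map_ofNat] using h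
      · rw [presF, extendZero_of_not_lt _ hj, lie_zero, lie_zero]
    · rw [presF, extendZero_of_not_lt _ hi, zero_lie]

variable (n d) in
/-- The image of `𝔤𝔩ₙ` in the presented algebra. -/
def presRho : Mat n →ₗ[ℚ] Presented n d := rho n (presE n d) (presF n d) (presH n d)

theorem presRho_bracket (X Y : Mat n) :
    presRho n d X * presRho n d Y - presRho n d Y * presRho n d X =
      presRho n d (X * Y - Y * X) :=
  rho_bracket (presented_chevalleyRel n d) X Y

theorem presRho_diag (k : Fin n) : presRho n d (unit k k) = cartan n d (coord n d k) := by
  rw [presRho, rho_unit, rootVec_self, presH, extendZero_val]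

theorem presRho_e (i : Fin (n - 1)) :
    presRho n d (unit (idx i) (idxSucc i)) = toPresented n d (gE d i) := by
  have h := rootVec_pos (presE n d) (presF n d) (presH n d) i 0
  rw [presRho, rho_unit]
  refine Eq.trans h ?_
  rw [posRoot, presE, extendZero_val]

theorem presRho_f (i : Fin (n - 1)) :
    presRho n d (unit (idxSucc i) (idx i)) = toPresented n d (gF d i) := by
  have h := rootVec_neg (presE n d) (presF n d) (presH n d) i 0
  rw [presRho, rho_unit]
  refine Eq.trans h ?_
  rw [posRoot, Pi.neg_apply, neg_neg, presF, extendZero_val]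

/-- ΣH_k takes the value Σλ_k = d on every 1_λ. -/
theorem presRho_one : presRho n d 1 = algebraMap ℚ _ (d : ℚ) := by
  have h : (1 : Mat n) = ∑ k, unit k k := by
    rw [← Matrix.diagonal_one, ← Matrix.sum_single_eq_diagonal]
  rw [h, map_sum]
  simp only [presRho_diag]
  rw [← map_sum, ← (cartan n d).commutes]
  congr 1
  ext l
  rw [Finset.sum_apply, Pi.algebraMap_apply]
  simp only [coord, ← Nat.cast_sum, l.2]
  rfl

/-- The function `c` is a product of falling factorials of the λ_k, with lengths given by how often
k occurs in `w`. It is nonzero only where every λ_k is at least that multiplicity. -/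
theorem normalProd_diag (r : ℕ) (w : Fin r → Fin n) :
    ∃ c : Lam n d → ℚ, normalProd (presRho n d) r (fun t => unit (w t) (w t)) = cartan n d c ∧
      ∀ l, c l ≠ 0 → ∀ k, (∑ t, if w t = k then 1 else 0) ≤ l.1 k := by
  induction r with
  | zero => exact ⟨1, by rw [map_one, normalProd_zero], by simp⟩
  | succ r ih =>
    induction w using Fin.consCases with | _ i w =>
    obtain ⟨c, hc, hcl⟩ := ih w
    set N : ℕ := ∑ t, if w t = i then 1 else 0 with hN
    -- Left multiplication by E_ii fixes the `N` entries equal to E_ii and kills the others, so one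
    -- more E_ii multiplies by H_i - N.
    refine ⟨(coord n d i - algebraMap ℚ _ (N : ℚ)) * c, ?_, ?_⟩
    · have h1 : (fun t => unit ((Fin.cons i w : Fin (r + 1) → Fin n) t)
          ((Fin.cons i w : Fin (r + 1) → Fin n) t)) =
          (Fin.cons (unit i i) fun t => unit (w t) (w t) : Fin (r + 1) → Mat n) := by
        funext t
        refine Fin.cases rfl (fun t => rfl) t
      rw [h1, normalProd_cons, presRho_diag, hc, map_mul, map_sub, sub_mul, AlgHom.commutes,
        ← hc, der_apply]
      congr 1
      rw [hN, Nat.cast_sum, map_sum, Finset.sum_mul]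
      refine Finset.sum_congr rfl fun t _ => ?_
      rw [LinearMap.mulLeft_apply, unit_mul_unit]
      by_cases h : w t = i
      · rw [if_pos h.symm, if_pos h, Nat.cast_one, map_one, one_mul]
        congr 1
        rw [Function.update_eq_self_iff, h]
      · rw [if_neg (Ne.symm h), if_neg h, MultilinearMap.map_update_zero]
        simp
    · intro l hl k
      have h1 := left_ne_zero_of_mul hl
      have h2 := hcl l (right_ne_zero_of_mul hl)
      have h3 : l.1 i ≠ N := fun h => h1 (by simp [coord, h])
      rw [Fin.sum_univ_succ]
      simp only [Fin.cons_zero, Fin.cons_succ]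
      have h4 := h2 k
      split_ifs with h
      · subst h; omega
      · omega

/-- On diagonal units, a nonzero coefficient at λ would force the d + 1 factors to fit under the
λ_k, whose sum is d. -/
theorem normalProd_presRho_eq_zero (v : Fin (d + 1) → Mat n) :
    normalProd (presRho n d) (d + 1) v = 0 := by
  refine normalProd_eq_zero presRho_bracket (fun w => ?_) v
  obtain ⟨c, hc, hcl⟩ := normalProd_diag (d := d) (d + 1) w
  have h0 : c = 0 := by
    ext l
    by_contra h
    have h1 := Finset.sum_le_sum fun k (_ : k ∈ Finset.univ) => hcl l h k
    rw [Finset.sum_comm, l.2] at h1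
    simp at h1
  rw [hc, h0, map_zero]

theorem presRho_mul_normalProd (X : Mat n) (v : Fin d → Mat n) :
    presRho n d X * normalProd (presRho n d) d v =
      der (lm X) (normalProd (presRho n d) d) v := by
  rw [map_mul_normalProd, normalProd_presRho_eq_zero, zero_add]

theorem normalProd_presRho_one :
    normalProd (presRho n d) d (fun _ => 1) = algebraMap ℚ _ (d.factorial : ℚ) := by
  rw [normalProd_one presRho_one d le_rfl, Nat.descFactorial_self]

end Presented


/-! ### The representation on tensor space -/

section Tensor

variable {n d : ℕ}

theorem tprod_ext {W : Type*} [AddCommGroup W] [Module ℚ W] {f g : TensorSpace n d →ₗ[ℚ] W}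
    (h : ∀ v, f (PiTensorProduct.tprod ℚ v) = g (PiTensorProduct.tprod ℚ v)) : f = g :=
  PiTensorProduct.ext (MultilinearMap.ext h)

theorem glAction_tprod (X : Mat n) (v : Fin d → V n) :
    glAction n d X (PiTensorProduct.tprod ℚ v) =
      der (Matrix.toLin' X) (PiTensorProduct.tprod ℚ) v := by
  rw [glAction, LinearMap.sum_apply, der_apply]
  refine Finset.sum_congr rfl fun k _ => ?_
  rw [PiTensorProduct.map_tprod]
  congr 1
  funext t
  by_cases h : t = k
  · subst h; simp
  · simp [h]

variable (n d) in
/-- The action of `𝔤𝔩ₙ` on tensor space, as a linear map. -/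
def glLin : Mat n →ₗ[ℚ] Module.End ℚ (TensorSpace n d) where
  toFun := glAction n d
  map_add' X Y := by
    refine tprod_ext fun v => ?_
    simp [glAction_tprod, der_add_left]
  map_smul' c X := by
    refine tprod_ext fun v => ?_
    simp [glAction_tprod, der_smul_left]

theorem glLin_apply (X : Mat n) : glLin n d X = glAction n d X := rfl

theorem glLin_bracket (X Y : Mat n) :
    glLin n d X * glLin n d Y - glLin n d Y * glLin n d X = glLin n d (X * Y - Y * X) := by
  have h (X : Mat n) : (glAction n d X).compMultilinearMap (PiTensorProduct.tprod ℚ) =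
      der (Matrix.toLin' X) (PiTensorProduct.tprod ℚ : MultilinearMap ℚ (fun _ : Fin d => V n) _) := by
    exact MultilinearMap.ext fun v => glAction_tprod X v
  refine tprod_ext fun v => ?_
  have h1 := congrArg (fun F => F v) (der_der_sub (Matrix.toLin' Y) (Matrix.toLin' X)
    (PiTensorProduct.tprod ℚ : MultilinearMap ℚ (fun _ : Fin d => V n) _))
  simp only [LinearMap.sub_apply, Module.End.mul_apply,
    glLin_apply, glAction_tprod]
  rw [← LinearMap.compMultilinearMap_apply, ← LinearMap.compMultilinearMap_apply,
    ← der_compMultilinearMap, ← der_compMultilinearMap, h, h]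
  refine Eq.trans h1 ?_
  rw [map_sub, Matrix.toLin'_mul, Matrix.toLin'_mul]
  rfl

variable (n d) in
/-- The standard basis of tensor space. -/
def tensorBasis : Module.Basis (Fin d → Fin n) ℚ (TensorSpace n d) :=
  Basis.piTensorProduct fun _ => Pi.basisFun ℚ (Fin n)

theorem tensorBasis_apply (J : Fin d → Fin n) :
    tensorBasis n d J = PiTensorProduct.tprod ℚ fun t => Pi.single (J t) (1 : ℚ) := by
  simp [tensorBasis]

theorem glAction_unit (k l : Fin n) (J : Fin d → Fin n) :
    glAction n d (unit k l) (tensorBasis n d J) =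
      ∑ t, if J t = l then tensorBasis n d (Function.update J t k) else 0 := by
  rw [tensorBasis_apply, glAction_tprod, der_apply]
  refine Finset.sum_congr rfl fun t _ => ?_
  have h : Matrix.toLin' (unit k l) (Pi.single (J t) (1 : ℚ)) =
      if J t = l then Pi.single k 1 else 0 := by
    rw [Matrix.toLin'_apply, Matrix.mulVec_single_one]
    ext p
    simp only [Matrix.col_apply, Matrix.single_apply]
    by_cases hl : J t = l
    · simp [hl, Pi.single_apply, eq_comm]
    · simp [hl, Ne.symm hl]
  rw [h]
  split_ifs with hl
  · rw [tensorBasis_apply]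
    congr 1
    funext s
    by_cases hs : s = t
    · subst hs; simp
    · simp [hs]
  · rw [MultilinearMap.map_update_zero]

/-- The weight of a standard basis vector. -/
def weight (J : Fin d → Fin n) : Lam n d :=
  ⟨fun k => ∑ t, if J t = k then 1 else 0, by rw [Finset.sum_comm]; simp⟩

theorem weight_update (J : Fin d → Fin n) (t : Fin d) (k : Fin n) :
    (weight (Function.update J t k)).toInt =
      (weight J).toInt + (Pi.single k 1 - Pi.single (J t) 1) := by
  funext p
  simp only [Lam.toInt, weight, Pi.add_apply, Pi.sub_apply, Pi.single_apply, Nat.cast_sum,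
    Nat.cast_ite, Nat.cast_one, Nat.cast_zero]
  rw [← Finset.add_sum_erase _ _ (Finset.mem_univ t),
    ← Finset.add_sum_erase _ (fun t => if J t = p then (1 : ℤ) else 0) (Finset.mem_univ t)]
  have h : ∑ s ∈ Finset.univ.erase t, (if Function.update J t k s = p then (1 : ℤ) else 0) =
      ∑ s ∈ Finset.univ.erase t, if J s = p then (1 : ℤ) else 0 :=
    Finset.sum_congr rfl fun s hs => by rw [Function.update_of_ne (Finset.ne_of_mem_erase hs)]
  rw [h, Function.update_self]
  simp only [eq_comm (a := p)]
  ring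

theorem toInt_injective : Function.Injective (Lam.toInt : Lam n d → Fin n → ℤ) := by
  intro l m h
  refine Subtype.ext (funext fun k => ?_)
  exact Int.ofNat_inj.1 (congrFun h k)

theorem hOp_apply (k : Fin n) (J : Fin d → Fin n) :
    hOp n d k (tensorBasis n d J) = ((weight J).1 k : ℚ) • tensorBasis n d J := by
  rw [hOp, glAction_unit, weight, Nat.cast_sum, Finset.sum_smul]
  refine Finset.sum_congr rfl fun t _ => ?_
  split_ifs with h
  · rw [← h, Function.update_eq_self]; simp
  · simp

theorem inv_factorial_mul_descPochhammer (m b : ℕ) :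
    (b.factorial : ℚ)⁻¹ * (descPochhammer ℚ b).eval (m : ℚ) = m.choose b := by
  rw [descPochhammer_eval_eq_descFactorial, Nat.descFactorial_eq_factorial_mul_choose,
    Nat.cast_mul, inv_mul_cancel_left₀ (by exact_mod_cast b.factorial_ne_zero)]

theorem binom_hOp_apply (k : Fin n) (b : ℕ) (J : Fin d → Fin n) :
    binom (hOp n d k) b (tensorBasis n d J) =
      (((weight J).1 k).choose b : ℚ) • tensorBasis n d J := by
  have h : (hOp n d k).HasEigenvector ((weight J).1 k : ℚ) (tensorBasis n d J) :=
    ⟨Module.End.mem_eigenspace_iff.2 (hOp_apply k J), (tensorBasis n d).ne_zero J⟩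
  rw [binom, LinearMap.smul_apply, Module.End.aeval_apply_of_hasEigenvector h, smul_smul,
    inv_factorial_mul_descPochhammer]

theorem list_prod_apply {W : Type*} [AddCommGroup W] [Module ℚ W] {m : ℕ}
    {f : Fin m → Module.End ℚ W} {c : Fin m → ℚ} {x : W} (h : ∀ k, f k x = c k • x) :
    (List.ofFn f).prod x = (∏ k, c k) • x := by
  induction m with
  | zero => simp
  | succ m ih =>
    rw [List.ofFn_succ, List.prod_cons, Module.End.mul_apply, ih fun k => h k.succ, map_smul, h,
      smul_smul, Fin.prod_univ_succ, mul_comm]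

/-- If no factor vanishes then l ≤ m in every coordinate; as both sum to d, they are equal. -/
theorem prod_choose (l m : Lam n d) :
    ∏ k, ((m.1 k).choose (l.1 k) : ℚ) = if m = l then 1 else 0 := by
  split_ifs with h
  · subst h; simp
  · by_contra h0
    rw [← ne_eq, Finset.prod_ne_zero_iff] at h0
    have h1 : ∀ k ∈ Finset.univ, l.1 k ≤ m.1 k := fun k hk => by
      by_contra h2
      exact h0 k hk (by rw [Nat.choose_eq_zero_of_lt (not_le.1 h2), Nat.cast_zero])
    have h2 := (Finset.sum_eq_sum_iff_of_le h1).1 (l.2.trans m.2.symm)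
    exact h (Subtype.ext (funext fun k => (h2 k (Finset.mem_univ k)).symm))

theorem HOp_apply (l : Lam n d) (J : Fin d → Fin n) :
    HOp n d l.1 (tensorBasis n d J) = if weight J = l then tensorBasis n d J else 0 := by
  rw [HOp, list_prod_apply fun k => binom_hOp_apply k (l.1 k) J, prod_choose, ite_smul, one_smul,
    zero_smul]

theorem glAction_mul_HOp_apply (k p : Fin n) (l : Lam n d) (J : Fin d → Fin n) :
    (glAction n d (unit k p) * HOp n d l.1) (tensorBasis n d J) =
      ∑ t, if J t = p ∧ weight J = l then tensorBasis n d (Function.update J t k) else 0 := by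
  rw [Module.End.mul_apply, HOp_apply]
  by_cases h : weight J = l
  · simp [h, glAction_unit]
  · simp [h]

theorem HOp_mul_glAction_apply (k p : Fin n) (l : Lam n d) (J : Fin d → Fin n) :
    (HOp n d l.1 * glAction n d (unit k p)) (tensorBasis n d J) =
      ∑ t, if J t = p ∧ weight (Function.update J t k) = l then
        tensorBasis n d (Function.update J t k) else 0 := by
  rw [Module.End.mul_apply, glAction_unit, map_sum]
  refine Finset.sum_congr rfl fun t _ => ?_
  by_cases h : J t = p
  · simp [h, HOp_apply]
  · simp [h]

theorem glAction_mul_HOp {k p : Fin n} {l m : Lam n d}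
    (h : m.toInt = l.toInt + (Pi.single k 1 - Pi.single p 1)) :
    glAction n d (unit k p) * HOp n d l.1 = HOp n d m.1 * glAction n d (unit k p) := by
  refine (tensorBasis n d).ext fun J => ?_
  rw [glAction_mul_HOp_apply, HOp_mul_glAction_apply]
  refine Finset.sum_congr rfl fun t _ => ?_
  refine if_congr (and_congr_right fun ht => ?_) rfl rfl
  rw [← toInt_injective.eq_iff, ← toInt_injective.eq_iff, weight_update, h, ht, add_left_inj]

theorem glAction_mul_HOp_eq_zero {k p : Fin n} {l : Lam n d}
    (h : ∀ m : Lam n d, m.toInt ≠ l.toInt + (Pi.single k 1 - Pi.single p 1)) :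
    glAction n d (unit k p) * HOp n d l.1 = 0 := by
  refine (tensorBasis n d).ext fun J => ?_
  rw [glAction_mul_HOp_apply]
  refine Finset.sum_eq_zero fun t _ => if_neg fun ⟨ht, hw⟩ => ?_
  exact h (weight (Function.update J t k)) (by rw [weight_update, ht, hw])

theorem HOp_mul_glAction_eq_zero {k p : Fin n} {l : Lam n d}
    (h : ∀ m : Lam n d, m.toInt ≠ l.toInt - (Pi.single k 1 - Pi.single p 1)) :
    HOp n d l.1 * glAction n d (unit k p) = 0 := by
  refine (tensorBasis n d).ext fun J => ?_
  rw [HOp_mul_glAction_apply]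
  refine Finset.sum_eq_zero fun t _ => if_neg fun ⟨ht, hw⟩ => ?_
  exact h (weight J) (by rw [← hw, weight_update, ht, add_sub_cancel_right])

theorem sum_smul_HOp_apply (c : Lam n d → ℚ) (J : Fin d → Fin n) :
    (∑ l : Lam n d, c l • HOp n d l.1) (tensorBasis n d J) =
      c (weight J) • tensorBasis n d J := by
  rw [LinearMap.sum_apply, Finset.sum_eq_single (weight J)]
  · rw [LinearMap.smul_apply, HOp_apply, if_pos rfl]
  · intro l _ hl
    rw [LinearMap.smul_apply, HOp_apply, if_neg hl.symm, smul_zero]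
  · simp

theorem sum_coord_smul_HOp (k : Fin n) :
    ∑ l : Lam n d, coord n d k l • HOp n d l.1 = hOp n d k :=
  (tensorBasis n d).ext fun J => by rw [sum_smul_HOp_apply, hOp_apply]; rfl

/-- The Serre expression is a double commutator, hence the action of the corresponding double
commutator of matrices. -/
theorem serre_glAction {X Y : Mat n} (h : X * (X * Y - Y * X) - (X * Y - Y * X) * X = 0) :
    glAction n d X ^ 2 * glAction n d Y - 2 * glAction n d X * glAction n d Y * glAction n d X +
      glAction n d Y * glAction n d X ^ 2 = 0 := by
  have h1 := glLin_bracket (d := d) X (X * Y - Y * X)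
  rw [h, map_zero, ← glLin_bracket] at h1
  simp only [glLin_apply] at h1
  exact (commutator_commutator (glAction n d X) (glAction n d Y)).symm.trans h1

variable (n d) in
/-- The images of the generators in the Schur algebra. -/
def genOp : Gen n d → Module.End ℚ (TensorSpace n d)
  | .one l => HOp n d l.1
  | .e i => eOp n d i
  | .f i => fOp n d i

theorem lift_genOp_one (l : Lam n d) :
    FreeAlgebra.lift ℚ (genOp n d) (gOne l) = HOp n d l.1 :=
  FreeAlgebra.lift_ι_apply _ _

theorem lift_genOp_e (i : Fin (n - 1)) :
    FreeAlgebra.lift ℚ (genOp n d) (gE d i) = glAction n d (unit (idx i) (idxSucc i)) :=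
  FreeAlgebra.lift_ι_apply _ _

theorem lift_genOp_f (i : Fin (n - 1)) :
    FreeAlgebra.lift ℚ (genOp n d) (gF d i) = glAction n d (unit (idxSucc i) (idx i)) :=
  FreeAlgebra.lift_ι_apply _ _

theorem neg_simpleRoot (i : Fin (n - 1)) :
    (Pi.single (idxSucc i) 1 - Pi.single (idx i) 1 : Fin n → ℤ) = -simpleRoot i := by
  rw [simpleRoot, neg_sub]

theorem commute_glAction {X Y : Mat n} (h : X * Y - Y * X = 0) :
    glAction n d X * glAction n d Y - glAction n d Y * glAction n d X = 0 := by
  have := glLin_bracket (d := d) X Y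
  rwa [h, map_zero] at this

theorem lift_genOp_rel {a b : Free n d} (h : Rel n d a b) :
    FreeAlgebra.lift ℚ (genOp n d) a = FreeAlgebra.lift ℚ (genOp n d) b := by
  induction h with
  | one_mul_one l m =>
    rw [map_mul, lift_genOp_one, lift_genOp_one]
    refine (tensorBasis n d).ext fun J => ?_
    rw [Module.End.mul_apply, HOp_apply]
    by_cases hlm : l = m
    · subst hlm
      rw [if_pos rfl, lift_genOp_one, HOp_apply]
      split_ifs with hJ
      · rw [HOp_apply, if_pos hJ]
      · simp
    · rw [if_neg hlm, map_zero]
      split_ifs with hJ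
      · rw [HOp_apply, if_neg fun h => hlm (h.symm.trans hJ)]; rfl
      · simp
  | sum_one =>
    rw [map_sum, map_one]
    simp only [lift_genOp_one]
    refine (tensorBasis n d).ext fun J => ?_
    have := sum_smul_HOp_apply (fun _ => 1) J
    simpa using this
  | e_one i l m h =>
    rw [map_mul, map_mul, lift_genOp_e, lift_genOp_one, lift_genOp_one]
    exact glAction_mul_HOp h
  | e_one_zero i l h =>
    rw [map_mul, map_zero, lift_genOp_e, lift_genOp_one]
    exact glAction_mul_HOp_eq_zero h
  | f_one i l m h =>
    rw [map_mul, map_mul, lift_genOp_f, lift_genOp_one, lift_genOp_one]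
    exact glAction_mul_HOp (by rw [h, neg_simpleRoot, sub_eq_add_neg])
  | f_one_zero i l h =>
    rw [map_mul, map_zero, lift_genOp_f, lift_genOp_one]
    exact glAction_mul_HOp_eq_zero (by simpa only [neg_simpleRoot, ← sub_eq_add_neg] using h)
  | one_e i l m h =>
    rw [map_mul, map_mul, lift_genOp_e, lift_genOp_one, lift_genOp_one]
    exact (glAction_mul_HOp (by rw [h, ← simpleRoot, sub_add_cancel])).symm
  | one_e_zero i l h =>
    rw [map_mul, map_zero, lift_genOp_e, lift_genOp_one]
    exact HOp_mul_glAction_eq_zero h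
  | one_f i l m h =>
    rw [map_mul, map_mul, lift_genOp_f, lift_genOp_one, lift_genOp_one]
    exact (glAction_mul_HOp (by rw [h, neg_simpleRoot, add_neg_cancel_right])).symm
  | one_f_zero i l h =>
    rw [map_mul, map_zero, lift_genOp_f, lift_genOp_one]
    exact HOp_mul_glAction_eq_zero (by simpa only [neg_simpleRoot, sub_neg_eq_add] using h)
  | e_f i j =>
    rw [map_sub, map_mul, map_mul, lift_genOp_e, lift_genOp_f]
    refine (glLin_bracket _ _).trans ?_
    rw [unit_mul_unit, unit_mul_unit]
    have hinj : idxSucc i = idxSucc j ↔ i = j := by simp [idxSucc, Fin.ext_iff]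
    have hinj' : idx j = idx i ↔ i = j := by simp [idx, Fin.ext_iff, eq_comm]
    simp only [hinj, hinj']
    by_cases hij : i = j
    · subst hij
      simp only [if_true, map_sum, map_smul, lift_genOp_one, map_sub, glLin_apply]
      have h1 := sum_coord_smul_HOp (d := d) (idx i)
      have h2 := sum_coord_smul_HOp (d := d) (idxSucc i)
      rw [hOp] at h1 h2
      rw [← h1, ← h2]
      refine (Finset.sum_sub_distrib (fun l : Lam n d => coord n d (idx i) l • HOp n d l.1)
        (fun l => coord n d (idxSucc i) l • HOp n d l.1)).symm.trans ?_
      exact Finset.sum_congr rfl fun l _ => 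
        (sub_smul (coord n d (idx i) l) (coord n d (idxSucc i) l) (HOp n d l.1)).symm
    · simp [hij]
  | serre_e i j h =>
    simp only [map_add, map_sub, map_mul, map_pow, map_zero, map_ofNat, lift_genOp_e]
    refine serre_glAction ?_
    rw [abs_eq zero_le_one] at h
    rcases h with h | h <;>
      simp [unit_mul_unit, mul_sub, sub_mul, mul_ite, ite_mul, idx, idxSucc, Fin.ext_iff] <;>
      split_ifs <;> first | omega | simp
  | comm_e i j h =>
    simp only [map_sub, map_mul, map_zero, lift_genOp_e]
    refine commute_glAction ?_
    rw [ne_eq, abs_eq zero_le_one] at h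
    rw [unit_mul_unit, unit_mul_unit, if_neg, if_neg, sub_zero] <;>
      simp only [idx, idxSucc, Fin.ext_iff] <;> omega
  | serre_f i j h =>
    simp only [map_add, map_sub, map_mul, map_pow, map_zero, map_ofNat, lift_genOp_f]
    refine serre_glAction ?_
    rw [abs_eq zero_le_one] at h
    rcases h with h | h <;>
      simp [unit_mul_unit, mul_sub, sub_mul, mul_ite, ite_mul, idx, idxSucc, Fin.ext_iff] <;>
      split_ifs <;> first | omega | simp
  | comm_f i j h =>
    simp only [map_sub, map_mul, map_zero, lift_genOp_f]
    refine commute_glAction ?_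
    rw [ne_eq, abs_eq zero_le_one] at h
    rw [unit_mul_unit, unit_mul_unit, if_neg, if_neg, sub_zero] <;>
      simp only [idx, idxSucc, Fin.ext_iff] <;> omega

variable (n d) in
/-- The representation of the presented algebra on tensor space. -/
def tensorRep : Presented n d →ₐ[ℚ] Module.End ℚ (TensorSpace n d) :=
  RingQuot.liftAlgHom ℚ ⟨FreeAlgebra.lift ℚ (genOp n d), fun _ _ h => lift_genOp_rel h⟩

theorem tensorRep_toPresented (x : Free n d) :
    tensorRep n d (toPresented n d x) = FreeAlgebra.lift ℚ (genOp n d) x :=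
  RingQuot.liftAlgHom_mkAlgHom_apply _ _ _ _

/-- Both sides respect brackets, so agreement on the E_{i,i+1}, E_{i+1,i} and E_kk is enough. -/
theorem tensorRep_presRho (X : Mat n) : tensorRep n d (presRho n d X) = glLin n d X := by
  refine mem_of_bracket_closed
    (S := LinearMap.eqLocus ((tensorRep n d).toLinearMap ∘ₗ presRho n d) (glLin n d))
    (fun X hX Y hY => ?_) (fun i => ?_) (fun i => ?_) (fun k => ?_) X
  · change tensorRep n d (presRho n d X) = glLin n d X at hX
    change tensorRep n d (presRho n d Y) = glLin n d Y at hY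
    change tensorRep n d (presRho n d (X * Y - Y * X)) = glLin n d (X * Y - Y * X)
    rw [← presRho_bracket, ← glLin_bracket, map_sub, map_mul, map_mul, hX, hY]
  · change tensorRep n d (presRho n d _) = _
    rw [presRho_e, tensorRep_toPresented, lift_genOp_e]; rfl
  · change tensorRep n d (presRho n d _) = _
    rw [presRho_f, tensorRep_toPresented, lift_genOp_f]; rfl
  · change tensorRep n d (presRho n d _) = _
    rw [presRho_diag, cartan_apply, map_sum]
    simp only [map_smul, tensorRep_toPresented, lift_genOp_one]
    exact sum_coord_smul_HOp k

end Tensor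


/-! ### The map back and injectivity -/

section Isomorphism

variable {n d : ℕ}

variable (n d) in
/-- The endomorphism `v₁ ⊗ ⋯ ⊗ v_d` of tensor space, as a multilinear map in the matrices `v_t`. -/
def tensorMap : MultilinearMap ℚ (fun _ : Fin d => Mat n) (Module.End ℚ (TensorSpace n d)) :=
  (PiTensorProduct.mapMultilinear ℚ (fun _ : Fin d => V n) (fun _ => V n)).compLinearMap
    fun _ => (Matrix.toLin' : Mat n ≃ₗ[ℚ] _).toLinearMap

theorem tensorMap_tprod (v : Fin d → Mat n) (u : Fin d → V n) :
    tensorMap n d v (PiTensorProduct.tprod ℚ u) =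
      PiTensorProduct.tprod ℚ fun t => Matrix.toLin' (v t) (u t) :=
  PiTensorProduct.map_tprod _ _

theorem tensorMap_one : tensorMap n d (fun _ => 1) = 1 := by
  refine tprod_ext fun u => ?_
  rw [tensorMap_tprod]
  simp

theorem glLin_mul_tensorMap (X : Mat n) (v : Fin d → Mat n) :
    glLin n d X * tensorMap n d v = der (lm X) (tensorMap n d) v := by
  refine tprod_ext fun u => ?_
  rw [Module.End.mul_apply, tensorMap_tprod, glLin_apply, glAction_tprod, der_apply, der_apply,
    LinearMap.sum_apply]
  refine Finset.sum_congr rfl fun t _ => ?_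
  rw [tensorMap_tprod]
  congr 1
  funext s
  by_cases h : s = t
  · subst h
    rw [Function.update_self, Function.update_self, LinearMap.mulLeft_apply, Matrix.toLin'_mul]
    rfl
  · rw [Function.update_of_ne h, Function.update_of_ne h]

variable (n d) in
/-- The basis of `End(V^{⊗ d})` by the matrix units with respect to the standard basis. -/
def endBasis :
    Module.Basis ((Fin d → Fin n) × (Fin d → Fin n)) ℚ (Module.End ℚ (TensorSpace n d)) :=
  (tensorBasis n d).linearMap (tensorBasis n d)

theorem endBasis_apply (p : (Fin d → Fin n) × (Fin d → Fin n)) :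
    endBasis n d p = tensorMap n d fun t => unit (p.1 t) (p.2 t) := by
  refine (tensorBasis n d).ext fun J => ?_
  rw [endBasis, Module.Basis.linearMap_apply_apply]
  simp only [tensorBasis_apply]
  rw [tensorMap_tprod]
  have h (t : Fin d) : Matrix.toLin' (unit (p.1 t) (p.2 t)) (Pi.single (J t) (1 : ℚ)) =
      if p.2 t = J t then Pi.single (p.1 t) 1 else 0 := by
    rw [Matrix.toLin'_apply, Matrix.mulVec_single_one]
    ext q
    simp only [Matrix.col_apply, Matrix.single_apply]
    by_cases hl : p.2 t = J t
    · simp [hl, Pi.single_apply, eq_comm]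
    · simp [hl]
  split_ifs with hJ
  · congr 1
    funext t
    rw [h, if_pos (congrFun hJ t)]
  · obtain ⟨t, ht⟩ := Function.ne_iff.1 hJ
    exact ((PiTensorProduct.tprod ℚ).map_coord_zero t (by rw [h, if_neg ht])).symm

variable (n d) in
/-- The linear map from `End(V^{⊗ d})` to the presented algebra sending `v₁ ⊗ ⋯ ⊗ v_d` to the
normally ordered product of the `v_t`. -/
def toPresEnd : Module.End ℚ (TensorSpace n d) →ₗ[ℚ] Presented n d :=
  (endBasis n d).constr ℚ fun p => normalProd (presRho n d) d fun t => unit (p.1 t) (p.2 t)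

theorem toPresEnd_comp_tensorMap :
    (toPresEnd n d).compMultilinearMap (tensorMap n d) = normalProd (presRho n d) d := by
  refine Module.Basis.ext_multilinear (fun _ => Matrix.stdBasis ℚ (Fin n) (Fin n)) fun p => ?_
  have h : (fun t => Matrix.stdBasis ℚ (Fin n) (Fin n) (p t)) =
      fun t => unit (p t).1 (p t).2 := funext fun t => Matrix.stdBasis_eq_single _ _ _
  have h1 : toPresEnd n d (endBasis n d (fun t => (p t).1, fun t => (p t).2)) =
      normalProd (presRho n d) d fun t => unit (p t).1 (p t).2 :=
    (endBasis n d).constr_basis ℚ _ _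
  rw [endBasis_apply] at h1
  rw [h]
  exact h1

theorem toPresEnd_one : toPresEnd n d 1 = algebraMap ℚ _ (d.factorial : ℚ) := by
  rw [← tensorMap_one, ← LinearMap.compMultilinearMap_apply, toPresEnd_comp_tensorMap,
    normalProd_presRho_one]

/-- Since products of length d + 1 vanish, `X` multiplies v₁ ⊗ ⋯ ⊗ v_d and its normal product by the
same Leibniz rule. -/
theorem toPresEnd_glLin_mul (X : Mat n) (f : Module.End ℚ (TensorSpace n d)) :
    toPresEnd n d (glLin n d X * f) = presRho n d X * toPresEnd n d f := by
  have h : toPresEnd n d ∘ₗ lm (glLin n d X) = lm (presRho n d X) ∘ₗ toPresEnd n d := by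
    have h1 := der_compMultilinearMap (M := Mat n)
      (N := Module.End ℚ (TensorSpace n d)) (lm X) (toPresEnd n d) (tensorMap n d)
    rw [toPresEnd_comp_tensorMap] at h1
    refine (endBasis n d).ext fun p => ?_
    rw [endBasis_apply, LinearMap.comp_apply, LinearMap.comp_apply, LinearMap.mulLeft_apply,
      LinearMap.mulLeft_apply, glLin_mul_tensorMap, ← LinearMap.compMultilinearMap_apply,
      ← LinearMap.compMultilinearMap_apply, toPresEnd_comp_tensorMap, presRho_mul_normalProd, h1]
  exact congrArg (fun g => g f) h

variable (n d) in
/-- The elements over which `toPresEnd` is linear. -/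
def equivariant : Subalgebra ℚ (Presented n d) where
  carrier := {x | ∀ f, toPresEnd n d (tensorRep n d x * f) = x * toPresEnd n d f}
  mul_mem' := fun {x y} hx hy f => by
    rw [map_mul (tensorRep n d), mul_assoc, hx, hy, mul_assoc]
  add_mem' := fun {x y} hx hy f => by
    rw [map_add (tensorRep n d), add_mul, map_add, hx, hy, add_mul]
  algebraMap_mem' := fun c f => by
    rw [AlgHom.commutes, ← Algebra.smul_def, ← Algebra.smul_def, map_smul]

theorem presRho_mem_equivariant (X : Mat n) : presRho n d X ∈ equivariant n d := fun f => by
  rw [tensorRep_presRho, toPresEnd_glLin_mul]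

theorem single_eq_prod_binom (l : Lam n d) :
    (Pi.single l 1 : Lam n d → ℚ) = ∏ k, binom (coord n d k) (l.1 k) := by
  ext m
  have h (k : Fin n) : binom (coord n d k) (l.1 k) m = ((m.1 k).choose (l.1 k) : ℚ) := by
    have h1 := Polynomial.aeval_algHom_apply (Pi.evalAlgHom ℚ (fun _ : Lam n d => ℚ) m)
      (coord n d k) (descPochhammer ℚ (l.1 k))
    simp only [Pi.evalAlgHom_apply] at h1
    rw [binom, Pi.smul_apply, ← h1, Polynomial.coe_aeval_eq_eval, smul_eq_mul]
    exact inv_factorial_mul_descPochhammer _ _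
  rw [Finset.prod_apply, Pi.single_apply]
  simp only [h]
  rw [prod_choose]

/-- As a function on compositions, the indicator of λ is a product of binomials in the coordinates.
So 1_λ is a polynomial in the H_k, which are images of matrices. -/
theorem one_mem_equivariant (l : Lam n d) : toPresented n d (gOne l) ∈ equivariant n d := by
  rw [← cartan_single]
  change _ ∈ (equivariant n d).comap (cartan n d)
  rw [single_eq_prod_binom]
  refine Subalgebra.prod_mem _ fun k _ => Subalgebra.smul_mem _ ?_ _
  have hk : coord n d k ∈ (equivariant n d).comap (cartan n d) := by
    change cartan n d (coord n d k) ∈ equivariant n d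
    rw [← presRho_diag]
    exact presRho_mem_equivariant _
  exact Algebra.adjoin_le (Set.singleton_subset_iff.2 hk)
    (Polynomial.aeval_mem_adjoin_singleton ℚ (coord n d k))

theorem presented_induction {S : Subalgebra ℚ (Presented n d)}
    (h1 : ∀ l, toPresented n d (gOne l) ∈ S) (he : ∀ i, toPresented n d (gE d i) ∈ S)
    (hf : ∀ i, toPresented n d (gF d i) ∈ S) (x : Presented n d) : x ∈ S := by
  obtain ⟨y, rfl⟩ := RingQuot.mkAlgHom_surjective ℚ (Rel n d) x
  induction y using FreeAlgebra.induction with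
  | grade0 c => rw [AlgHom.commutes]; exact S.algebraMap_mem c
  | grade1 g =>
    cases g with
    | one l => exact h1 l
    | e i => exact he i
    | f i => exact hf i
  | mul a b ha hb => rw [map_mul]; exact S.mul_mem ha hb
  | add a b ha hb => rw [map_add]; exact S.add_mem ha hb

/-- Equivariance evaluated at the identity endomorphism reads 0 = x · d! when `x` acts as zero. -/
theorem tensorRep_injective : Function.Injective (tensorRep n d) := by
  rw [injective_iff_map_eq_zero]
  intro x hx
  have h : x ∈ equivariant n d :=
    presented_induction one_mem_equivariant
      (fun i => by rw [← presRho_e]; exact presRho_mem_equivariant _)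
      (fun i => by rw [← presRho_f]; exact presRho_mem_equivariant _) x
  have h1 := h 1
  rw [hx, zero_mul, map_zero, toPresEnd_one, ← Algebra.commutes, ← Algebra.smul_def] at h1
  exact (smul_eq_zero.1 h1.symm).resolve_left (by exact_mod_cast d.factorial_ne_zero)

/-! ### The image is the whole Schur algebra -/

theorem placePerm_tprod (σ : Equiv.Perm (Fin d)) (u : Fin d → V n) :
    placePerm n d σ (PiTensorProduct.tprod ℚ u) = PiTensorProduct.tprod ℚ (u ∘ σ.symm) :=
  PiTensorProduct.reindex_tprod σ u

theorem glAction_mem_schurAlgebra (X : Mat n) : glAction n d X ∈ SchurAlgebra n d := by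
  rw [SchurAlgebra, Subalgebra.mem_centralizer_iff]
  rintro _ ⟨σ, rfl⟩
  refine tprod_ext fun u => ?_
  rw [Module.End.mul_apply, Module.End.mul_apply, placePerm_tprod, glAction_tprod, glAction_tprod,
    der_apply, der_apply, map_sum, ← Equiv.sum_comp σ fun t => PiTensorProduct.tprod ℚ
      (Function.update (u ∘ σ.symm) t (Matrix.toLin' X ((u ∘ σ.symm) t)))]
  refine Finset.sum_congr rfl fun t _ => ?_
  rw [placePerm_tprod, Function.update_comp_equiv, Equiv.symm_symm, Function.comp_apply,
    Equiv.symm_apply_apply]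

theorem HOp_mem_schurAlgebra (B : Fin n → ℕ) : HOp n d B ∈ SchurAlgebra n d := by
  refine Subalgebra.list_prod_mem _ fun x hx => ?_
  obtain ⟨k, rfl⟩ := (List.mem_ofFn' _ _).1 hx
  exact Subalgebra.smul_mem _ (Algebra.adjoin_le
    (Set.singleton_subset_iff.2 (glAction_mem_schurAlgebra _))
    (Polynomial.aeval_mem_adjoin_singleton ℚ (hOp n d k))) _

theorem tensorRep_mem_schurAlgebra (x : Presented n d) : tensorRep n d x ∈ SchurAlgebra n d := by
  refine presented_induction (S := (SchurAlgebra n d).comap (tensorRep n d))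
    (fun l => ?_) (fun i => ?_) (fun i => ?_) x
  · rw [Subalgebra.mem_comap, tensorRep_toPresented, lift_genOp_one]
    exact HOp_mem_schurAlgebra _
  · rw [Subalgebra.mem_comap, tensorRep_toPresented, lift_genOp_e]
    exact glAction_mem_schurAlgebra _
  · rw [Subalgebra.mem_comap, tensorRep_toPresented, lift_genOp_f]
    exact glAction_mem_schurAlgebra _

/-- The symmetrization of `v₁ ⊗ ⋯ ⊗ v_d`. -/
def symTensor (v : Fin d → Mat n) : Module.End ℚ (TensorSpace n d) :=
  ∑ σ : Equiv.Perm (Fin d), tensorMap n d (v ∘ σ)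

theorem symTensor_comp (v : Fin d → Mat n) (τ : Equiv.Perm (Fin d)) :
    symTensor (v ∘ τ) = symTensor v :=
  Equiv.sum_comp (Equiv.mulLeft τ) fun σ => tensorMap n d (v ∘ σ)

theorem glLin_mul_symTensor (X : Mat n) (v : Fin d → Mat n) :
    glLin n d X * symTensor v = ∑ t, symTensor (Function.update v t (X * v t)) := by
  simp only [symTensor]
  rw [Finset.mul_sum, Finset.sum_comm]
  refine Finset.sum_congr rfl fun σ _ => ?_
  rw [glLin_mul_tensorMap, der_apply,
    ← Equiv.sum_comp σ fun t => tensorMap n d (Function.update v t (X * v t) ∘ σ)]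
  refine Finset.sum_congr rfl fun t _ => ?_
  rw [Function.update_comp_equiv, Equiv.symm_apply_apply]
  rfl

theorem mem_of_add_mem {A : Type*} [Ring A] [Algebra ℚ A] {S : Subalgebra ℚ A} {a b : A}
    (hab : a + b ∈ S) (ha : a ∈ S) : b ∈ S := by
  simpa using S.sub_mem hab ha

theorem symTensor_mem_range (v : Fin d → Mat n) : symTensor v ∈ (tensorRep n d).range := by
  suffices h : ∀ s : Finset (Fin d), ∀ v : Fin d → Mat n, (∀ t ∉ s, v t = 1) →
      symTensor v ∈ (tensorRep n d).range from
    h Finset.univ v fun t ht => absurd (Finset.mem_univ t) ht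
  intro s
  induction s using Finset.induction_on with
  | empty =>
    intro v hv
    have h1 : v = fun _ => 1 := funext fun t => hv t (Finset.notMem_empty t)
    rw [h1]
    refine Subalgebra.sum_mem _ fun σ _ => ?_
    have h2 : ((fun _ => 1 : Fin d → Mat n) ∘ σ) = fun _ => 1 := rfl
    rw [h2, tensorMap_one]
    exact Subalgebra.one_mem _
  | insert a s ha ih =>
    intro v hv
    -- The factor `v a` is removed and restored by the action of the matrix `v a`. Where it meets a
    -- factor in `s`, the induction hypothesis applies; where it meets an identity factor, the
    -- result is `symTensor v` up to a transposition. The latter count is nonzero because `a` is not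
    -- in `s`.
    set v' := Function.update v a 1 with hv'
    have hv's : ∀ t ∉ s, v' t = 1 := fun t ht => by
      by_cases hta : t = a
      · subst hta; simp [hv']
      · rw [hv', Function.update_of_ne hta]; exact hv t (by simp [hta, ht])
    have h1 : glLin n d (v a) * symTensor v' ∈ (tensorRep n d).range :=
      Subalgebra.mul_mem _ ⟨presRho n d (v a), tensorRep_presRho _⟩ (ih v' hv's)
    rw [glLin_mul_symTensor, ← Finset.sum_add_sum_compl s] at h1
    have h2 : ∑ t ∈ s, symTensor (Function.update v' t (v a * v' t)) ∈ (tensorRep n d).range := by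
      refine Subalgebra.sum_mem _ fun t ht => ih _ fun p hp => ?_
      rw [Function.update_of_ne (ne_of_mem_of_not_mem ht hp).symm]
      exact hv's p hp
    have h3 : ∀ t ∈ sᶜ, symTensor (Function.update v' t (v a * v' t)) = symTensor v := by
      intro t ht
      have hts : t ∉ s := Finset.mem_compl.1 ht
      rw [hv's t hts, mul_one, ← symTensor_comp v (Equiv.swap a t)]
      congr 1
      funext p
      rw [Function.comp_apply]
      by_cases hpt : p = t
      · subst hpt; simp
      rw [Function.update_of_ne hpt]
      by_cases hpa : p = a
      · subst hpa
        rw [Equiv.swap_apply_left, hv's p ha, hv t (by simp [hts, Ne.symm hpt])]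
      · rw [Equiv.swap_apply_of_ne_of_ne hpa hpt, hv', Function.update_of_ne hpa]
    rw [Finset.sum_congr rfl h3, Finset.sum_const, ← Nat.cast_smul_eq_nsmul ℚ] at h1
    have h4 := mem_of_add_mem (A := Module.End ℚ (TensorSpace n d)) h1 h2
    have h5 : ((sᶜ.card : ℕ) : ℚ) ≠ 0 :=
      Nat.cast_ne_zero.2 (Finset.card_ne_zero_of_mem (Finset.mem_compl.2 ha))
    have h6 := Subalgebra.smul_mem _ h4 ((sᶜ.card : ℕ) : ℚ)⁻¹
    rwa [smul_smul, inv_mul_cancel₀ h5, one_smul] at h6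

theorem placePerm_mul_tensorMap_mul (σ : Equiv.Perm (Fin d)) (v : Fin d → Mat n) :
    placePerm n d σ⁻¹ * tensorMap n d v * placePerm n d σ = tensorMap n d (v ∘ σ) := by
  refine tprod_ext fun u => ?_
  rw [Module.End.mul_apply, Module.End.mul_apply, placePerm_tprod, tensorMap_tprod,
    placePerm_tprod, tensorMap_tprod]
  congr 1
  funext t
  change Matrix.toLin' (v (σ t)) (u (σ.symm (σ t))) = _
  rw [Equiv.symm_apply_apply]
  rfl

theorem placePerm_inv_mul (σ : Equiv.Perm (Fin d)) :
    placePerm n d σ⁻¹ * placePerm n d σ = 1 := by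
  have h := placePerm_mul_tensorMap_mul (n := n) σ fun _ => 1
  have h2 : ((fun _ => 1 : Fin d → Mat n) ∘ σ) = fun _ => 1 := rfl
  rwa [h2, tensorMap_one, mul_one] at h

theorem sum_conj_mem_range (f : Module.End ℚ (TensorSpace n d)) :
    ∑ σ : Equiv.Perm (Fin d), placePerm n d σ⁻¹ * f * placePerm n d σ ∈
      (tensorRep n d).range := by
  induction (endBasis n d).mem_span f using Submodule.span_induction with
  | zero => simp
  | mem f hf =>
    obtain ⟨p, rfl⟩ := hf
    rw [endBasis_apply]
    simp only [placePerm_mul_tensorMap_mul]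
    exact symTensor_mem_range _
  | add f g _ _ hf hg =>
    simp only [mul_add, add_mul, Finset.sum_add_distrib]
    exact Subalgebra.add_mem _ hf hg
  | smul c f _ hf =>
    simp only [mul_smul_comm, smul_mul_assoc, ← Finset.smul_sum]
    exact Subalgebra.smul_mem _ hf c

/-- An element commuting with all place permutations equals each of its conjugates, so d! times it
is the sum over conjugates. -/
theorem mem_range_of_mem_schurAlgebra {f : Module.End ℚ (TensorSpace n d)}
    (hf : f ∈ SchurAlgebra n d) : f ∈ (tensorRep n d).range := by
  have h := sum_conj_mem_range f
  rw [SchurAlgebra, Subalgebra.mem_centralizer_iff] at hf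
  have h1 : ∀ σ ∈ (Finset.univ : Finset (Equiv.Perm (Fin d))),
      placePerm n d σ⁻¹ * f * placePerm n d σ = f := fun σ _ => by
    rw [mul_assoc, ← hf _ ⟨σ, rfl⟩, ← mul_assoc, placePerm_inv_mul, one_mul]
  rw [Finset.sum_congr rfl h1, Finset.sum_const, ← Nat.cast_smul_eq_nsmul ℚ] at h
  have h2 : (((Finset.univ : Finset (Equiv.Perm (Fin d))).card : ℕ) : ℚ) ≠ 0 :=
    Nat.cast_ne_zero.2 (Finset.card_ne_zero_of_mem (Finset.mem_univ 1))
  have h3 := Subalgebra.smul_mem _ h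
    (((Finset.univ : Finset (Equiv.Perm (Fin d))).card : ℕ) : ℚ)⁻¹
  rwa [smul_smul, inv_mul_cancel₀ h2, one_smul] at h3

variable (n d) in
/-- The isomorphism from the presented algebra onto the Schur algebra. -/
def presentedEquiv : Presented n d ≃ₐ[ℚ] SchurAlgebra n d :=
  AlgEquiv.ofBijective ((tensorRep n d).codRestrict _ tensorRep_mem_schurAlgebra)
    ⟨fun _ _ h => tensorRep_injective (congrArg Subtype.val h), fun f => by
      obtain ⟨x, hx⟩ := mem_range_of_mem_schurAlgebra f.2
      exact ⟨x, Subtype.ext hx⟩⟩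

theorem coe_presentedEquiv (x : Free n d) :
    (presentedEquiv n d (toPresented n d x) : Module.End ℚ (TensorSpace n d)) =
      FreeAlgebra.lift ℚ (genOp n d) x :=
  tensorRep_toPresented x

end Isomorphism

end SchurPresentation

end

open SchurPresentation
theorem theorem4 (n d : ℕ) :
    ∃ φ : Presented n d ≃ₐ[ℚ] SchurAlgebra n d,
      (∀ l : Lam n d,
        (φ (toPresented n d (gOne l)) : Module.End ℚ (TensorSpace n d)) = HOp n d l.1) ∧
      (∀ i : Fin (n - 1),
        (φ (toPresented n d (gE d i)) : Module.End ℚ (TensorSpace n d)) = eOp n d i) ∧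
      (∀ i : Fin (n - 1),
        (φ (toPresented n d (gF d i)) : Module.End ℚ (TensorSpace n d)) = fOp n d i) := by
  refine ⟨presentedEquiv n d, fun l => ?_, fun i => ?_, fun i => ?_⟩
  · rw [coe_presentedEquiv, lift_genOp_one]
  · rw [coe_presentedEquiv, lift_genOp_e]; rfl
  · rw [coe_presentedEquiv, lift_genOp_f]; rfl
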